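/- **Lower bound on jump discontinuities.** Let $\lambda,\kappa>0$ and $|\theta|<\sqrt{2\kappa}$. On a complete probability space $(\Omega,\mathcal F,\mathbb P)$ let $B,W$ be independent standard Brownian motions, let $s_0\ge 0$ be a random variable and let $\nu_0$ be a finite random measure supported on $[s_0,\infty)$, such that $(s_0,\nu_0)$ is independent of $(B,W)$. Let $(\mathcal F_t)_{t\ge0}$ be the augmented right-continuous filtration generated by $W$, with $\mathcal F_0$ enlarged so that $s_0,\nu_0$ are $\mathcal F_0$-measurable, and let $\mathcal F_\infty=\sigma(\bigcup_t\mathcal F_t)$. Let $s$ be an $\mathcal F_t$-adapted process whose paths are non-decreasing, right-continuous and $[0,\infty)$-valued, and which solves $$X^y_t=y+\sqrt{2\kappa-\theta^2}\,B_t+\theta W_t,\qquad \tau^y=\inf\{t\ge0: X^y_t\le s(t)\},$$ $$s(t)=s_0+\frac1{\lambda\kappa}\int_{[s_0,\infty)}\mathbb P(\tau^y\le t\mid\mathcal F_t)\,\nu_0(\mathrm dy)\quad\text{almost surely, for every } t\ge0 .$$ Here, for a $\sigma$-algebra $\mathcal G\supseteq\sigma(s_0,\nu_0)$ and events $E^y$,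 the expression $\int_{[s_0,\infty)}\mathbb P(E^y\mid\mathcal G)\,\nu_0(\mathrm dy)$ denotes the conditional expectation given $\mathcal G$ of $\int_{[s_0,\infty)}\mathbf 1_{E^y}\,\nu_0(\mathrm dy)$. Then $$s(0)-s_0\ \ge\ \inf\Bigl\{y>0:\ \frac1{\lambda\kappa}\nu_0([s_0,s_0+y])<y\Bigr\}\quad\text{almost surely.}$$ Moreover, the finite random measures $$\nu(t,\mathrm dx)=\int_{[s_0,\infty)}\mathbb P(X^y_t\in\mathrm dx,\ t<\tau^y\mid\mathcal F_\infty)\,\nu_0(\mathrm dy),\qquad t\ge0,$$ admit a version that is almost surely càdlàg in $t$ for weak convergence, and for any such version, with left limits $\nu(t-,\cdot)$, and any $\mathcal F_t$-stopping time $\tau$, $$s(\tau)-s(\tau-)\ \ge\ \inf\Bigl\{y>0:\ \frac1{\lambda\kappa}\nu(\tau-,[s(\tau-),s(\tau-)+y])<y\Bigr\}$$ almost surely on the event $\{\tau\in(0,\infty)\}$. -/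

import Mathlib

open MeasureTheory ProbabilityTheory Filter Topology Set
open scoped NNReal ENNReal

namespace StefanMV

variable {Ω : Type*} {mΩ : MeasurableSpace Ω}

/-- The augmented filtration generated by `W`, with the time-zero σ-algebra enlarged by the random
variable `s₀`, the random measure `ν₀` and all `P`-null sets, before passing to right limits. -/
noncomputable def augmentedFiltration (P : Measure Ω) [P.IsComplete]
    (W : ℝ≥0 → Ω → ℝ) (hW : ∀ t, Measurable (W t))
    (s₀ : Ω → ℝ) (hs₀ : Measurable s₀)
    (ν₀ : Ω → Measure ℝ) (hν₀ : Measurable ν₀) : Filtration ℝ≥0 mΩ where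
  seq t := (⨆ r ≤ t, MeasurableSpace.comap (W r) inferInstance) ⊔
    MeasurableSpace.comap s₀ inferInstance ⊔ MeasurableSpace.comap ν₀ inferInstance ⊔
    MeasurableSpace.generateFrom {N | P N = 0}
  mono' := fun _ _ hst => sup_le_sup_right (sup_le_sup_right (sup_le_sup_right
    (biSup_mono fun _ hr => hr.trans hst) _) _) _
  le' := fun _ => sup_le (sup_le (sup_le (iSup₂_le fun r _ => (hW r).comap_le) hs₀.comap_le)
    hν₀.comap_le) (MeasurableSpace.generateFrom_le fun N hN => Measure.IsComplete.out' N hN)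

/-- The filtration `(ℱ_t)`: the augmented right-continuous filtration generated by `W`, where
`ℱ_0` is enlarged so that `s₀` and `ν₀` are `ℱ_0`-measurable. -/
noncomputable def frontFiltration (P : Measure Ω) [P.IsComplete]
    (W : ℝ≥0 → Ω → ℝ) (hW : ∀ t, Measurable (W t))
    (s₀ : Ω → ℝ) (hs₀ : Measurable s₀)
    (ν₀ : Ω → Measure ℝ) (hν₀ : Measurable ν₀) : Filtration ℝ≥0 mΩ :=
  (augmentedFiltration P W hW s₀ hs₀ ν₀ hν₀).rightCont

/-- The particle `X^y_t = y + √(2κ - θ²) B_t + θ W_t`. -/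
noncomputable def particle (κ θ : ℝ) (B W : ℝ≥0 → Ω → ℝ) (y : ℝ) (t : ℝ≥0) (ω : Ω) : ℝ :=
  y + √(2 * κ - θ ^ 2) * B t ω + θ * W t ω

/-- The absorption time `τ^y = inf {t ≥ 0 : X^y_t ≤ s(t)}`, with value `∞` if the set is empty. -/
noncomputable def absorptionTime (κ θ : ℝ) (B W s : ℝ≥0 → Ω → ℝ) (y : ℝ) (ω : Ω) : ℝ≥0∞ :=
  sInf ((fun t : ℝ≥0 => (t : ℝ≥0∞)) '' {t | particle κ θ B W y t ω ≤ s t ω})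

/-- For an event `E y` depending on a parameter `y`, and a random measure `ν₀` that is measurable
with respect to the σ-algebra `𝒢`, this is `∫_{[s₀, ∞)} P(E y | 𝒢) ν₀(dy)`.
The conditional probabilities `P(E y | 𝒢)` are only determined up to a null set for each of the
uncountably many `y`, so for a random `ν₀` the integral is given its meaning by the conditional
Fubini theorem, as the conditional expectation given `𝒢` of
`∫_{[s₀, ∞)} 1_{E y} ν₀(dy) = ν₀({y ≥ s₀ : E y})`. -/
noncomputable def condMass (P : Measure Ω) (𝒢 : MeasurableSpace Ω) (s₀ : Ω → ℝ)
    (ν₀ : Ω → Measure ℝ) (E : ℝ → Set Ω) : Ω → ℝ≥0∞ :=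
  condLExp 𝒢 P (fun ω => ν₀ ω {y | s₀ ω ≤ y ∧ ω ∈ E y})

/-- Solutions `s` of the conditional McKean–Vlasov problem: `s` is an `ℱ`-adapted process whose
paths are non-decreasing, right-continuous and `[0, ∞)`-valued, such that, for every `t ≥ 0`,
`s(t) = s₀ + (1 / (lam κ)) ∫_{[s₀, ∞)} P(τ^y ≤ t | ℱ_t) ν₀(dy)` almost surely. -/
structure IsSolution (P : Measure Ω) (ℱ : Filtration ℝ≥0 mΩ) (lam κ θ : ℝ) (B W : ℝ≥0 → Ω → ℝ)
    (s₀ : Ω → ℝ) (ν₀ : Ω → Measure ℝ) (s : ℝ≥0 → Ω → ℝ) : Prop where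
  adapted : ∀ t, Measurable[ℱ t] (s t)
  nonneg : ∀ ω t, 0 ≤ s t ω
  mono : ∀ ω, Monotone fun t => s t ω
  rightCts : ∀ ω t, ContinuousWithinAt (fun r => s r ω) (Ici t) t
  eq : ∀ t, ∀ᵐ ω ∂P, s t ω = s₀ ω + 1 / (lam * κ) *
    (condMass P (ℱ t) s₀ ν₀ (fun y => {ω | absorptionTime κ θ B W s y ω ≤ t}) ω).toReal

/-- The process of finite random measures
`ν(t, dx) = ∫_{[s₀, ∞)} P(X^y_t ∈ dx, t < τ^y | ℱ_∞) ν₀(dy)`, in a version that is càdlàg in `t`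
for the topology of weak convergence, that is, `t ↦ ∫ φ(x) ν(t, dx)` is càdlàg for all bounded
continuous `φ`. Here `ℱ_∞` is the σ-algebra generated by all `ℱ_t`. -/
structure IsMassProcess (P : Measure Ω) (ℱ : Filtration ℝ≥0 mΩ) (κ θ : ℝ) (B W : ℝ≥0 → Ω → ℝ)
    (s₀ : Ω → ℝ) (ν₀ : Ω → Measure ℝ) (s : ℝ≥0 → Ω → ℝ)
    (ν : ℝ≥0 → Ω → FiniteMeasure ℝ) : Prop where
  version : ∀ t, ∀ A : Set ℝ, MeasurableSet A → ∀ᵐ ω ∂P, (ν t ω : Measure ℝ) A =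
    condMass P (⨆ r, ℱ r) s₀ ν₀
      (fun y => {ω | particle κ θ B W y t ω ∈ A ∧ (t : ℝ≥0∞) < absorptionTime κ θ B W s y ω}) ω
  rightCts : ∀ᵐ ω ∂P, ∀ t, ContinuousWithinAt (fun r => ν r ω) (Ici t) t
  leftLims : ∀ᵐ ω ∂P, ∀ t, 0 < t → ∃ μ, Tendsto (fun r => ν r ω) (𝓝[<] t) (𝓝 μ)

/-- The bound `inf {y > 0 : (1 / (lam κ)) μ([x, x + y]) < y}` for a front located at `x` and a
finite measure `μ`; the set is nonempty and bounded below. -/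
noncomputable def minimalJump (lam κ : ℝ) (μ : Measure ℝ) (x : ℝ) : ℝ :=
  sInf {y : ℝ | 0 < y ∧ 1 / (lam * κ) * μ.real (Icc x (x + y)) < y}

end StefanMV

/-!
The driving noise `B` is independent of `𝓕_∞`, so conditioning on `𝓕_t` or `𝓕_∞` amounts to freezing
the environment `(s₀, ν₀, W, s)` of a scenario `ω` and averaging over an independent copy of `B`
(`condLExp_diag_of_indep`, `IsEnvironment.condMass_ae_eq`). For almost every frozen environment the
equation of the front then says that the displacement `s(t) - s₀` is `1 / (lam κ)` times the mass
absorbed up to time `t` under the finite measure `initLaw P s₀ ν₀ ω` on pairs of a starting point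
and a noise path (`IsEnvironment.ae_measure_compl_alive_eq`). The law of the positions of the
survivors is càdlàg by dominated convergence, with left limits given by the particles that survive
on `[0, t)`, and it is a version of `ν(t, ·)`; any other càdlàg version is indistinguishable from it
(`IsEnvironment.isMassProcess_lawOn`, `IsMassProcess.ae_eq`).

Suppose that at a time `t` the front jumps by `J`, less than the asserted bound. Then for some
`q > J` the mass in `[s(t-), s(t-) + y]` just before `t` is at least `lam κ y` for all `y < q`. Take
`u > t` with `θ W_u ≤ θ W_t`, let `N` be the increment of `√(2κ - θ²) B` over `[t, u]` and put
`a = s(u) - s(t) - θ (W_u - W_t)`, so `a ≥ s(u) - s(t)`. A survivor at distance at most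
`max J (J + a - N)` from `s(t-)` is absorbed by time `u`, because it is below `s(t)` at time `t` or
below `s(u)` at time `u`. As `N` is independent of the survivors at time `t`
(`measure_aliveBefore_inter_eq_lintegral`), the mass absorbed in `[t, u]` is at least
`lam κ E[min (max J (J + a - N)) q]`. For symmetric non-degenerate `N` and small `a` this exceeds
`lam κ (J + a) ≥ lam κ (s(u) - s(t-))` (`lt_integral_clamp`), which contradicts the equation of the
front (`false_of_slow_front`).

Suitable `u` are found along a sequence decreasing to `t`: after an optional time the increments of
`θ W` are non-positive infinitely often along `τ + 1 / (n + 1)` with conditional probability at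
least `1 / 2` (`half_le_measure_frequently_le`). So the event of a slow jump at `τ` has probability
at most twice that of a null set (`measure_slowSet_eq_zero`). The time `0` is included, with `s₀` in
the role of `s(0-)`.
-/

namespace StefanMV

/-! ### Independence and conditional expectation -/

section Independence

variable {Ω : Type*} {mΩ : MeasurableSpace Ω} {P : Measure Ω}

theorem indep_sup_left_of_indep [IsProbabilityMeasure P] {m₁ m₂ m₃ : MeasurableSpace Ω}
    (h₁ : m₁ ≤ mΩ) (h₂ : m₂ ≤ mΩ) (h₃ : m₃ ≤ mΩ)
    (h : Indep m₁ (m₂ ⊔ m₃) P) (h' : Indep m₂ m₃ P) : Indep (m₁ ⊔ m₂) m₃ P := by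
  have hgen : m₁ ⊔ m₂ = MeasurableSpace.generateFrom
      (image2 (· ∩ ·) {s | MeasurableSet[m₁] s} {s | MeasurableSet[m₂] s}) := by
    refine le_antisymm (sup_le (fun s hs => ?_) (fun s hs => ?_))
      (MeasurableSpace.generateFrom_le ?_)
    · exact MeasurableSpace.measurableSet_generateFrom
        ⟨s, hs, univ, @MeasurableSet.univ _ m₂, by simp⟩
    · exact MeasurableSpace.measurableSet_generateFrom
        ⟨univ, @MeasurableSet.univ _ m₁, s, hs, by simp⟩
    · rintro _ ⟨a, ha, b, hb, rfl⟩
      exact @MeasurableSet.inter _ (m₁ ⊔ m₂) _ _ ((le_sup_left : m₁ ≤ m₁ ⊔ m₂) _ ha)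
        ((le_sup_right : m₂ ≤ m₁ ⊔ m₂) _ hb)
  refine IndepSets.indep (sup_le h₁ h₂) h₃
    (p1 := image2 (· ∩ ·) {s | MeasurableSet[m₁] s} {s | MeasurableSet[m₂] s})
    (p2 := {s | MeasurableSet[m₃] s}) ?_ (@MeasurableSpace.isPiSystem_measurableSet _ m₃)
    hgen (@MeasurableSpace.generateFrom_measurableSet _ m₃).symm ?_
  · rintro _ ⟨a, ha, b, hb, rfl⟩ _ ⟨c, hc, d, hd, rfl⟩ -
    exact ⟨a ∩ c, @MeasurableSet.inter _ m₁ _ _ ha hc, b ∩ d, @MeasurableSet.inter _ m₂ _ _ hb hd,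
      by simp only; ac_rfl⟩
  · rw [IndepSets_iff]
    rintro _ C ⟨A, hA, B, hB, rfl⟩ hC
    rw [Indep_iff] at h h'
    have hBC : MeasurableSet[m₂ ⊔ m₃] (B ∩ C) :=
      @MeasurableSet.inter _ (m₂ ⊔ m₃) _ _ ((le_sup_left : m₂ ≤ m₂ ⊔ m₃) _ hB)
        ((le_sup_right : m₃ ≤ m₂ ⊔ m₃) _ hC)
    have hB' : MeasurableSet[m₂ ⊔ m₃] B := (le_sup_left : m₂ ≤ m₂ ⊔ m₃) _ hB
    simp only
    rw [inter_assoc, h _ _ hA hBC, h' _ _ hB hC, h _ _ hA hB', mul_assoc]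

/-- Adding null sets to the generators of `m` gives at most the completion of `m`. -/
theorem sup_generateFrom_null_le (m : MeasurableSpace Ω) :
    m ⊔ MeasurableSpace.generateFrom {N | P N = 0} ≤ eventuallyMeasurableSpace m (ae P) := by
  refine sup_le (le_eventuallyMeasurableSpace) (MeasurableSpace.generateFrom_le fun N hN => ?_)
  exact ⟨∅, MeasurableSet.empty, ae_eq_empty.2 hN⟩

theorem indep_eventuallyMeasurableSpace {m₁ m₂ : MeasurableSpace Ω} (h : Indep m₁ m₂ P) :
    Indep (eventuallyMeasurableSpace m₁ (ae P)) (eventuallyMeasurableSpace m₂ (ae P)) P := by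
  rw [Indep_iff] at h ⊢
  rintro s t ⟨s', hs', hss⟩ ⟨t', ht', htt⟩
  rw [measure_congr (hss.inter htt), measure_congr hss, measure_congr htt, h _ _ hs' ht']

theorem eventuallyMeasurableSpace_le [P.IsComplete] {m : MeasurableSpace Ω} (hm : m ≤ mΩ) :
    eventuallyMeasurableSpace m (ae P) ≤ mΩ := by
  rintro s ⟨t, ht, hst⟩
  exact (NullMeasurableSet.congr (hm _ ht).nullMeasurableSet hst.symm).measurable_of_complete

theorem measurable_of_ae_eq {m : MeasurableSpace Ω} (hnull : ∀ N, P N = 0 → MeasurableSet[m] N)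
    {β : Type*} [MeasurableSpace β] {f g : Ω → β} (hf : Measurable[m] f) (hfg : f =ᵐ[P] g) :
    Measurable[m] g := by
  intro s hs
  have h0 : P {ω | f ω ≠ g ω} = 0 := hfg
  have : g ⁻¹' s = (f ⁻¹' s \ {ω | f ω ≠ g ω}) ∪ (g ⁻¹' s ∩ {ω | f ω ≠ g ω}) := by
    ext ω
    by_cases h : f ω = g ω <;> simp [h]
  rw [this]
  exact @MeasurableSet.union _ m _ _ (@MeasurableSet.diff _ m _ _ (hf hs) (hnull _ h0))
    (hnull _ (measure_mono_null inter_subset_right h0))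

theorem lintegral_comp_of_indepFun [IsProbabilityMeasure P] {α β : Type*} [MeasurableSpace α]
    [MeasurableSpace β] {X : Ω → α} {Y : Ω → β} (hX : Measurable X) (hY : Measurable Y)
    (hXY : IndepFun X Y P) {f : α → β → ℝ≥0∞} (hf : Measurable (Function.uncurry f)) :
    ∫⁻ ω, f (X ω) (Y ω) ∂P = ∫⁻ ω, ∫⁻ ω', f (X ω) (Y ω') ∂P ∂P := by
  have := Measure.isProbabilityMeasure_map (μ := P) hX.aemeasurable
  have := Measure.isProbabilityMeasure_map (μ := P) hY.aemeasurable
  have h1 : ∫⁻ ω, f (X ω) (Y ω) ∂P =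
      ∫⁻ p, Function.uncurry f p ∂(P.map fun ω => (X ω, Y ω)) :=
    (lintegral_map hf (hX.prodMk hY)).symm
  have h2 : ∀ x, ∫⁻ y, f x y ∂(P.map Y) = ∫⁻ ω', f x (Y ω') ∂P := fun x =>
    lintegral_map (hf.comp measurable_prodMk_left) hY
  rw [h1, hXY.map_prod_eq_prod_map_map hX.aemeasurable hY.aemeasurable,
    lintegral_prod _ hf.aemeasurable]
  simp only [Function.uncurry_apply_pair, h2]
  have h3 : Measurable fun x => ∫⁻ ω', f x (Y ω') ∂P := by
    simp only [← h2]
    exact hf.lintegral_prod_right'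
  rw [lintegral_map h3 hX]

/-- Freezing the first argument: if `f` is jointly measurable for two independent σ-algebras, the
integral of `f` on the diagonal is the iterated integral. -/
theorem lintegral_diag_of_indep [IsProbabilityMeasure P] {m H : MeasurableSpace Ω}
    (hm : m ≤ mΩ) (hH : H ≤ mΩ) (hi : Indep m H P) {f : Ω → Ω → ℝ≥0∞}
    (hf : Measurable[m.prod H] (fun p : Ω × Ω => f p.1 p.2)) :
    ∫⁻ ω, f ω ω ∂P = ∫⁻ ω, ∫⁻ ω', f ω ω' ∂P ∂P := by
  have hid : @IndepFun Ω Ω Ω mΩ m H id id P := by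
    rw [@IndepFun_iff_Indep Ω Ω Ω mΩ m H]
    simpa only [MeasurableSpace.comap_id] using hi
  exact @lintegral_comp_of_indepFun Ω mΩ P _ Ω Ω m H id id hm hH hid f hf

theorem measurable_lintegral_snd [IsProbabilityMeasure P] {m H : MeasurableSpace Ω}
    (hH : H ≤ mΩ) {f : Ω → Ω → ℝ≥0∞}
    (hf : Measurable[m.prod H] (fun p : Ω × Ω => f p.1 p.2)) :
    Measurable[m] fun ω => ∫⁻ ω', f ω ω' ∂P := by
  have hf' : Measurable[m.prod mΩ] (fun p : Ω × Ω => f p.1 p.2) :=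
    hf.mono (sup_le_sup le_rfl (MeasurableSpace.comap_mono hH)) le_rfl
  exact @Measurable.lintegral_prod_right' Ω Ω m mΩ P _ _ hf'

/-- The conditional expectation of `ω ↦ f ω ω`, where the second argument is independent of the
conditioning, integrates out the second argument. -/
theorem condLExp_diag_of_indep [IsProbabilityMeasure P] {m H : MeasurableSpace Ω}
    (hm : m ≤ mΩ) (hH : H ≤ mΩ) (hi : Indep m H P) {f : Ω → Ω → ℝ≥0∞}
    (hf : Measurable[m.prod H] (fun p : Ω × Ω => f p.1 p.2)) :
    condLExp m P (fun ω => f ω ω) =ᵐ[P] fun ω => ∫⁻ ω', f ω ω' ∂P := by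
  symm
  refine ae_eq_condLExp hm P _ (measurable_lintegral_snd hH hf) fun A hA => ?_
  have hg : Measurable[m.prod H] (fun p : Ω × Ω => A.indicator 1 p.1 * f p.1 p.2) := by
    have h1 : Measurable[m] (A.indicator (1 : Ω → ℝ≥0∞)) :=
      Measurable.indicator (m := m) (f := fun _ => 1) (@measurable_const _ _ _ m _) hA
    exact (h1.comp (@measurable_fst Ω Ω m H)).mul hf
  have := lintegral_diag_of_indep hm hH hi (f := fun ω ω' => A.indicator 1 ω * f ω ω') hg
  rw [← lintegral_indicator (hm _ hA), ← lintegral_indicator (hm _ hA)]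
  have e1 : ∀ ω, A.indicator (fun ω => f ω ω) ω = A.indicator 1 ω * f ω ω := fun ω => by
    by_cases h : ω ∈ A <;> simp [h]
  have e2 : ∀ ω, A.indicator (fun ω => ∫⁻ ω', f ω ω' ∂P) ω =
      ∫⁻ ω', A.indicator 1 ω * f ω ω' ∂P := fun ω => by
    by_cases h : ω ∈ A <;> simp [h]
  simp only [e1, e2]
  exact this.symm

/-- If every event of a sequence has probability at least `c`, so has its limsup. -/
theorem le_measure_frequently [IsFiniteMeasure P] {E : ℕ → Set Ω}
    (hE : ∀ k, MeasurableSet (E k)) {c : ℝ≥0∞} (hc : ∀ k, c ≤ P (E k)) :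
    c ≤ P {ω | ∃ᶠ k in atTop, ω ∈ E k} := by
  have heq : {ω | ∃ᶠ k in atTop, ω ∈ E k} = ⋂ n, ⋃ k ≥ n, E k := by
    ext ω
    simp [frequently_atTop]
  have hanti : Antitone fun n => ⋃ k ≥ n, E k := fun a b hab =>
    biUnion_subset_biUnion_left fun k hk => le_trans hab hk
  rw [heq, hanti.measure_iInter (fun n => (MeasurableSet.iUnion fun k => MeasurableSet.iUnion
    fun _ => hE k).nullMeasurableSet) ⟨0, measure_ne_top _ _⟩]
  exact le_iInf fun n => (hc n).trans (measure_mono (subset_biUnion_of_mem (u := E) (le_refl n)))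

end Independence

/-! ### The mean of a clamped symmetric random variable -/

/-- Clamping `J + a - N` between the floor `J` and the ceiling `q`, for a non-degenerate symmetric
`N`, raises its mean `J + a` if the floor is closer to that mean than the ceiling. -/
theorem lt_integral_clamp {Ω : Type*} {mΩ : MeasurableSpace Ω} {P : Measure Ω}
    [IsProbabilityMeasure P] {N : Ω → ℝ} (hN : Integrable N P)
    (hsymm : P.map (fun ω => -N ω) = P.map N) (hpos : ∀ x, 0 < P {ω | x < N ω})
    {J q a : ℝ} (hJ : J < q) (h : 2 * a < q - J) :
    J + a < ∫ ω, min (max J (J + a - N ω)) q ∂P := by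
  have hint : ∀ b : ℝ, Integrable (fun ω => max (N ω - b) 0) P := fun b =>
    (hN.sub (integrable_const b)).pos_part
  have hint' : ∀ b : ℝ, Integrable (fun ω => max (-N ω - b) 0) P := fun b =>
    (hN.neg.sub (integrable_const b)).pos_part
  have hrefl : ∀ b : ℝ, ∫ ω, max (-N ω - b) 0 ∂P = ∫ ω, max (N ω - b) 0 ∂P := fun b => by
    have h1 : ∫ x, max (x - b) 0 ∂(P.map fun ω => -N ω) = ∫ ω, max (-N ω - b) 0 ∂P :=
      integral_map hN.neg.aemeasurable
        (by fun_prop : Continuous fun x : ℝ => max (x - b) 0).aestronglyMeasurable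
    have h2 : ∫ x, max (x - b) 0 ∂(P.map N) = ∫ ω, max (N ω - b) 0 ∂P :=
      integral_map hN.aemeasurable
        (by fun_prop : Continuous fun x : ℝ => max (x - b) 0).aestronglyMeasurable
    rw [← h1, hsymm, h2]
  have hmean : ∫ ω, N ω ∂P = 0 := by
    have h1 : ∫ x, x ∂(P.map fun ω => -N ω) = ∫ ω, -N ω ∂P :=
      integral_map hN.neg.aemeasurable continuous_id.aestronglyMeasurable
    have h2 : ∫ x, x ∂(P.map N) = ∫ ω, N ω ∂P :=
      integral_map hN.aemeasurable continuous_id.aestronglyMeasurable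
    rw [hsymm, h2, integral_neg] at h1
    linarith
  -- the floor adds `(N - a)⁺` to `J + a - N`, and the ceiling takes off `(-N - (q - J - a))⁺`
  have hpt : ∀ ω, min (max J (J + a - N ω)) q =
      (J + a - N ω) + (max (N ω - a) 0 - max (-N ω - (q - J - a)) 0) := fun ω => by
    rcases le_total (N ω - a) 0 with h1 | h1 <;>
    rcases le_total (-N ω - (q - J - a)) 0 with h2 | h2 <;>
    rcases le_total J (J + a - N ω) with h3 | h3 <;>
    simp only [h1, h2, h3, max_eq_left, max_eq_right, sub_zero, zero_sub, add_zero] <;>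
    first
    | (rw [min_eq_left (by linarith)]; linarith)
    | (rw [min_eq_right (by linarith)]; linarith)
    | (rw [min_def]; split_ifs <;> linarith)
  have hsum : ∫ ω, min (max J (J + a - N ω)) q ∂P =
      J + a + ∫ ω, (max (N ω - a) 0 - max (N ω - (q - J - a)) 0) ∂P := by
    simp only [hpt]
    have hi1 : Integrable (fun ω => J + a - N ω) P := (integrable_const _).sub hN
    have hi2 : Integrable (fun ω => max (N ω - a) 0 - max (-N ω - (q - J - a)) 0) P :=
      (hint _).sub (hint' _)
    rw [integral_add hi1 hi2, integral_sub (integrable_const _) hN, hmean,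
      integral_sub (hint _) (hint' _), hrefl, integral_sub (hint _) (hint _)]
    simp
  rw [hsum]
  have hgain : 0 < ∫ ω, (max (N ω - a) 0 - max (N ω - (q - J - a)) 0) ∂P := by
    have hi : Integrable (fun ω => max (N ω - a) 0 - max (N ω - (q - J - a)) 0) P :=
      (hint _).sub (hint _)
    rw [integral_pos_iff_support_of_nonneg _ hi]
    · refine (hpos a).trans_le (measure_mono fun ω (hω : a < N ω) => ?_)
      have : max (N ω - (q - J - a)) 0 < max (N ω - a) 0 := by
        rw [max_eq_left (by linarith : (0:ℝ) ≤ N ω - a)]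
        exact max_lt (by linarith) (by linarith)
      exact (sub_pos.2 this).ne'
    · intro ω
      exact sub_nonneg.2 (max_le_max (by linarith) le_rfl)
  linarith

/-! ### Survival of particles along a path -/

section Paths

open TopologicalSpace

variable {x f : ℝ≥0 → ℝ}

theorem upperSemicontinuous_of_monotone_of_rightCts (hf : Monotone f)
    (hfr : ∀ t, ContinuousWithinAt f (Ici t) t) : UpperSemicontinuous f := by
  intro t c hc
  have h1 : ∀ᶠ r in 𝓝[>] t, f r < c :=
    ((hfr t).mono Ioi_subset_Ici_self).eventually (gt_mem_nhds hc)
  obtain ⟨r, hr, htr⟩ := (h1.and self_mem_nhdsWithin).exists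
  filter_upwards [Iio_mem_nhds (show t < r from htr)] with u hu
  exact (hf (le_of_lt hu)).trans_lt hr

/-- The gap between a continuous path and a right-continuous non-decreasing front is lower
semicontinuous. -/
theorem lowerSemicontinuous_gap (hx : Continuous x) (hf : Monotone f)
    (hfr : ∀ t, ContinuousWithinAt f (Ici t) t) (y : ℝ) :
    LowerSemicontinuous fun r => y + x r - f r := by
  have h := upperSemicontinuous_of_monotone_of_rightCts hf hfr
  have h2 : LowerSemicontinuous fun r => -f r := fun t c hc => by
    filter_upwards [h t (-c) (by linarith)] with r hr
    linarith
  simpa [sub_eq_add_neg] using (continuous_const.add hx).lowerSemicontinuous.add h2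

theorem isClosed_absorbed (hx : Continuous x) (hf : Monotone f)
    (hfr : ∀ t, ContinuousWithinAt f (Ici t) t) (y : ℝ) :
    IsClosed {r | y + x r ≤ f r} := by
  have := (lowerSemicontinuous_gap hx hf hfr y).isClosed_preimage 0
  convert this using 1
  ext r
  simp

theorem exists_gt_forall_le_of_forall_le (hx : Continuous x) (hf : Monotone f)
    (hfr : ∀ t, ContinuousWithinAt f (Ici t) t) {y : ℝ} {t : ℝ≥0}
    (h : ∀ r ≤ t, f r < y + x r) : ∃ u > t, ∀ r < u, f r < y + x r := by
  have hopen := (isClosed_absorbed hx hf hfr y).isOpen_compl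
  have hmem : t ∈ {r | y + x r ≤ f r}ᶜ := by simpa using h t le_rfl
  obtain ⟨u, htu, hu⟩ := exists_Ico_subset_of_mem_nhds (hopen.mem_nhds hmem) ⟨t + 1, by simp⟩
  refine ⟨u, htu, fun r hr => ?_⟩
  rcases le_total r t with h' | h'
  · exact h r h'
  · simpa using hu ⟨h', hr⟩

/-- Survival up to time `t` is decided by countably many times, because the gap between particle
and front attains its minimum. -/
theorem forall_le_lt_iff_exists_forall_denseSeq (hx : Continuous x) (hf : Monotone f)
    (hfr : ∀ t, ContinuousWithinAt f (Ici t) t) (y : ℝ) (t : ℝ≥0) :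
    (∀ r ≤ t, f r < y + x r) ↔ ∃ n : ℕ, ∀ i : ℕ, 1 / ((n : ℝ) + 1) ≤
      y + x (min (denseSeq ℝ≥0 i) t) - f (min (denseSeq ℝ≥0 i) t) := by
  constructor
  · intro h
    obtain ⟨a, ha, hmin⟩ := LowerSemicontinuousOn.exists_isMinOn (s := Icc 0 t)
      ⟨0, by simp⟩ isCompact_Icc ((lowerSemicontinuous_gap hx hf hfr y).lowerSemicontinuousOn _)
    have hpos : 0 < y + x a - f a := by linarith [h a ha.2]
    obtain ⟨n, hn⟩ := exists_nat_one_div_lt hpos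
    exact ⟨n, fun i => hn.le.trans (hmin ⟨zero_le, min_le_right _ _⟩)⟩
  · rintro ⟨n, hn⟩ r hr
    have hn0 : (0 : ℝ) < 1 / ((n : ℝ) + 1) := by positivity
    suffices h : 1 / ((n : ℝ) + 1) ≤ y + x r - f r by linarith
    rcases hr.eq_or_lt with rfl | hr
    · obtain ⟨i, hi⟩ := (denseRange_denseSeq ℝ≥0).exists_mem_open isOpen_Ioi
        ⟨r + 1, show r + 1 ∈ Ioi r by simp⟩
      have := hn i
      rwa [min_eq_right (le_of_lt hi)] at this
    · by_contra! hlt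
      have h1 : ContinuousWithinAt (fun u => y + x u - f u) (Ici r) r :=
        ((continuous_const.add hx).continuousWithinAt).sub (hfr r)
      have h2 : ∀ᶠ u in 𝓝[≥] r, y + x u - f u < 1 / ((n : ℝ) + 1) :=
        h1.eventually (gt_mem_nhds hlt)
      obtain ⟨u, hru, hu⟩ := (mem_nhdsGE_iff_exists_Ico_subset' hr).1 h2
      have hru' : r < min u t := lt_min hru hr
      obtain ⟨i, hi⟩ := (denseRange_denseSeq ℝ≥0).exists_mem_open isOpen_Ioo
        (nonempty_Ioo.2 hru')
      have h3 : y + x (denseSeq ℝ≥0 i) - f (denseSeq ℝ≥0 i) < 1 / ((n : ℝ) + 1) :=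
        hu ⟨hi.1.le, hi.2.trans_le (min_le_left _ _)⟩
      have := hn i
      rw [min_eq_left (hi.2.le.trans (min_le_right _ _))] at this
      linarith

end Paths

/-- A particle is absorbed after time `t` if and only if it stays strictly above the front on
`[0, t]`: the infimum defining the absorption time is attained, since the set of times at which a
particle is at or below the front is closed. -/
theorem lt_absorptionTime_iff {Ω : Type*} {κ θ : ℝ} {B W s : ℝ≥0 → Ω → ℝ} {ω : Ω}
    (hB : Continuous fun t => B t ω) (hW : Continuous fun t => W t ω)
    (hs : Monotone fun t => s t ω) (hsr : ∀ t, ContinuousWithinAt (fun r => s r ω) (Ici t) t)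
    (y : ℝ) (t : ℝ≥0) :
    (t : ℝ≥0∞) < absorptionTime κ θ B W s y ω ↔
      ∀ r ≤ t, s r ω < y + (√(2 * κ - θ ^ 2) * B r ω + θ * W r ω) := by
  have hx : Continuous fun r => √(2 * κ - θ ^ 2) * B r ω + θ * W r ω :=
    (continuous_const.mul hB).add (continuous_const.mul hW)
  have hp : ∀ r, particle κ θ B W y r ω = y + (√(2 * κ - θ ^ 2) * B r ω + θ * W r ω) :=
    fun r => by rw [particle, add_assoc]
  constructor
  · intro h r hr
    by_contra! hle
    have : absorptionTime κ θ B W s y ω ≤ r :=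
      sInf_le ⟨r, by simpa [hp] using hle, rfl⟩
    exact absurd (this.trans (by exact_mod_cast hr)) (not_le.2 h)
  · intro h
    obtain ⟨u, htu, hu⟩ := exists_gt_forall_le_of_forall_le hx hs hsr h
    refine lt_of_lt_of_le (ENNReal.coe_lt_coe.2 htu) (le_sInf ?_)
    rintro _ ⟨r, hr, rfl⟩
    rw [mem_ofPred_eq, hp] at hr
    by_contra! hlt
    exact absurd (hu r (by exact_mod_cast hlt)) (not_lt.2 hr)

section Measurability

open TopologicalSpace

variable {γ : Type*} [MeasurableSpace γ] {y : γ → ℝ} {x f : ℝ≥0 → γ → ℝ}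

theorem measurableSet_forall_le (hxc : ∀ c, Continuous fun r => x r c)
    (hfm : ∀ c, Monotone fun r => f r c)
    (hfr : ∀ c t, ContinuousWithinAt (fun r => f r c) (Ici t) t) {t : ℝ≥0}
    (hy : Measurable y) (hx : ∀ r ≤ t, Measurable (x r)) (hf : ∀ r ≤ t, Measurable (f r)) :
    MeasurableSet {c | ∀ r ≤ t, f r c < y c + x r c} := by
  have : {c | ∀ r ≤ t, f r c < y c + x r c} = ⋃ n : ℕ, ⋂ i : ℕ, {c | 1 / ((n : ℝ) + 1) ≤
      y c + x (min (denseSeq ℝ≥0 i) t) c - f (min (denseSeq ℝ≥0 i) t) c} := by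
    ext c
    simp only [mem_ofPred_eq, mem_iUnion, mem_iInter]
    exact forall_le_lt_iff_exists_forall_denseSeq (hxc c) (hfm c) (hfr c) (y c) t
  rw [this]
  exact MeasurableSet.iUnion fun n => MeasurableSet.iInter fun i =>
    measurableSet_le measurable_const
      ((hy.add (hx _ (min_le_right _ _))).sub (hf _ (min_le_right _ _)))

/-- Survival on `[0, T)`, for a random time `T`. -/
theorem measurableSet_forall_lt (hxc : ∀ c, Continuous fun r => x r c)
    (hfm : ∀ c, Monotone fun r => f r c)
    (hfr : ∀ c t, ContinuousWithinAt (fun r => f r c) (Ici t) t) {t : ℝ≥0}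
    (hy : Measurable y) (hx : ∀ r ≤ t, Measurable (x r)) (hf : ∀ r ≤ t, Measurable (f r))
    {T : γ → ℝ≥0} (hT : Measurable T) (hTt : ∀ c, T c ≤ t) :
    MeasurableSet {c | ∀ r < T c, f r c < y c + x r c} := by
  have : {c | ∀ r < T c, f r c < y c + x r c} = ⋂ i : ℕ, {c | denseSeq ℝ≥0 i < T c →
      ∀ r ≤ denseSeq ℝ≥0 i, f r c < y c + x r c} := by
    ext c
    simp only [mem_ofPred_eq, mem_iInter]
    refine ⟨fun h i hi r hr => h r (hr.trans_lt hi), fun h r hr => ?_⟩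
    obtain ⟨i, hi⟩ := (denseRange_denseSeq ℝ≥0).exists_mem_open isOpen_Ioo (nonempty_Ioo.2 hr)
    exact h i hi.2 r hi.1.le
  rw [this]
  refine MeasurableSet.iInter fun i => ?_
  by_cases hi : denseSeq ℝ≥0 i < t
  · have h1 := measurableSet_forall_le hxc hfm hfr (t := denseSeq ℝ≥0 i) hy
      (fun r hr => hx r (hr.trans hi.le)) (fun r hr => hf r (hr.trans hi.le))
    exact (measurableSet_lt measurable_const hT).imp h1
  · convert MeasurableSet.univ (α := γ)
    rw [eq_univ_iff_forall]
    exact fun c hc => absurd (hc.trans_le (hTt c)) hi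

/-- Evaluation of a non-decreasing right-continuous process at a random time. -/
theorem measurable_eval_of_monotone (hfm : ∀ c, Monotone fun r => f r c)
    (hfr : ∀ c t, ContinuousWithinAt (fun r => f r c) (Ici t) t) {t : ℝ≥0}
    (hf : ∀ r ≤ t, Measurable (f r)) {T : γ → ℝ≥0} (hT : Measurable T) (hTt : ∀ c, T c ≤ t) :
    Measurable fun c => f (T c) c := by
  refine measurable_of_Iio fun b => ?_
  have : (fun c => f (T c) c) ⁻¹' Iio b = ⋃ i : ℕ,
      {c | T c < denseSeq ℝ≥0 i} ∩ {c | f (min (denseSeq ℝ≥0 i) t) c < b} := by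
    ext c
    simp only [mem_preimage, mem_Iio, mem_iUnion, mem_inter_iff, mem_ofPred_eq]
    constructor
    · intro h
      have h1 := upperSemicontinuous_of_monotone_of_rightCts (hfm c) (hfr c) (T c) b h
      obtain ⟨u, hu, hu'⟩ := exists_Ico_subset_of_mem_nhds h1 ⟨T c + 1, by simp⟩
      obtain ⟨i, hi⟩ := (denseRange_denseSeq ℝ≥0).exists_mem_open isOpen_Ioo (nonempty_Ioo.2 hu)
      exact ⟨i, hi.1, (hfm c (min_le_left _ _)).trans_lt (hu' ⟨hi.1.le, hi.2⟩)⟩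
    · rintro ⟨i, hi, h⟩
      exact (hfm c (le_min hi.le (hTt c))).trans_lt h
  rw [this]
  exact MeasurableSet.iUnion fun i => (measurableSet_lt hT measurable_const).inter
    (measurableSet_lt (hf _ (min_le_right _ _)) measurable_const)

theorem measurable_eval_of_continuous (hxc : ∀ c, Continuous fun r => x r c) {t : ℝ≥0}
    (hx : ∀ r ≤ t, Measurable (x r)) {T : γ → ℝ≥0} (hT : Measurable T) (hTt : ∀ c, T c ≤ t) :
    Measurable fun c => x (T c) c := by
  have h1 : Measurable (Function.uncurry fun r c => x (min r t) c) :=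
    measurable_uncurry_of_continuous_of_measurable
      (fun c => (hxc c).comp (continuous_id.min continuous_const))
      fun r => hx _ (min_le_right _ _)
  have h2 := h1.comp (hT.prodMk measurable_id)
  convert h2 using 1
  funext c
  simp [min_eq_left (hTt c)]

end Measurability

/-! ### Weak convergence of the surviving mass -/

/-- The law of `X` under the finite measure `μ` restricted to `S`. -/
noncomputable def lawOn {E : Type*} [MeasurableSpace E] (μ : Measure E) [IsFiniteMeasure μ]
    (S : Set E) (X : E → ℝ) : FiniteMeasure ℝ :=
  ⟨(μ.restrict S).map X, inferInstance⟩

/-- If the restricting sets converge pointwise and the maps converge pointwise, the laws converge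
weakly. -/
theorem tendsto_lawOn {E ι : Type*} [MeasurableSpace E] {μ : Measure E}
    [IsFiniteMeasure μ] {l : Filter ι} [l.IsCountablyGenerated] {S : ι → Set E} {S₀ : Set E}
    {X : ι → E → ℝ} {X₀ : E → ℝ} (hS : ∀ i, MeasurableSet (S i)) (hS₀ : MeasurableSet S₀)
    (hX : ∀ i, Measurable (X i)) (hX₀ : Measurable X₀)
    (hmem : ∀ p ∈ S₀, ∀ᶠ i in l, p ∈ S i) (hnot : ∀ p ∉ S₀, ∀ᶠ i in l, p ∉ S i)
    (hlim : ∀ p, Tendsto (fun i => X i p) l (𝓝 (X₀ p))) :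
    Tendsto (fun i => lawOn μ (S i) (X i)) l (𝓝 (lawOn μ S₀ X₀)) := by
  rw [FiniteMeasure.tendsto_iff_forall_integral_tendsto]
  intro φ
  have key : ∀ (A : Set E) (Y : E → ℝ), MeasurableSet A → Measurable Y →
      ∫ z, φ z ∂(lawOn μ A Y : Measure ℝ) = ∫ p, A.indicator (fun p => φ (Y p)) p ∂μ := by
    intro A Y hA hY
    rw [lawOn, FiniteMeasure.toMeasure_mk, integral_map hY.aemeasurable
      φ.continuous.aestronglyMeasurable, integral_indicator hA]
  simp only [key _ _ (hS _) (hX _), key _ _ hS₀ hX₀]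
  refine tendsto_integral_filter_of_dominated_convergence (fun _ => ‖φ‖) ?_ ?_
    (integrable_const _) ?_
  · exact Eventually.of_forall fun i =>
      ((φ.continuous.measurable.comp (hX i)).indicator (hS i)).aestronglyMeasurable
  · refine Eventually.of_forall fun i => Eventually.of_forall fun p => ?_
    exact (norm_indicator_le_norm_self _ _).trans (φ.norm_coe_le_norm _)
  · refine Eventually.of_forall fun p => ?_
    by_cases hp : p ∈ S₀
    · rw [indicator_of_mem hp]
      refine ((φ.continuous.tendsto _).comp (hlim p)).congr' ?_
      filter_upwards [hmem p hp] with i hi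
      rw [indicator_of_mem hi]
      rfl
    · rw [indicator_of_notMem hp]
      refine tendsto_const_nhds.congr' ?_
      filter_upwards [hnot p hp] with i hi
      rw [indicator_of_notMem hi]

/-! ### The mass absorbed just after a given time, for a frozen environment -/

section Frozen

variable {Ω : Type*}

/-- Pairs of a starting point `p.1` and a scenario `p.2` for which the particle `p.1 + x p.2` stays
strictly above the front `f` on `[0, t]`. -/
def alive (x : Ω → ℝ≥0 → ℝ) (f : ℝ≥0 → ℝ) (t : ℝ≥0) : Set (ℝ × Ω) :=
  {p | ∀ r ≤ t, f r < p.1 + x p.2 r}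

/-- Pairs of a starting point `p.1` and a scenario `p.2` for which the particle `p.1 + x p.2` stays
strictly above the front `f` on `[0, t)`. -/
def aliveBefore (x : Ω → ℝ≥0 → ℝ) (f : ℝ≥0 → ℝ) (t : ℝ≥0) : Set (ℝ × Ω) :=
  {p | ∀ r < t, f r < p.1 + x p.2 r}

theorem alive_anti {x : Ω → ℝ≥0 → ℝ} {f : ℝ≥0 → ℝ} : Antitone (alive x f) :=
  fun _ _ h _ hp r hr => hp r (hr.trans h)

theorem aliveBefore_subset_alive {x : Ω → ℝ≥0 → ℝ} {f : ℝ≥0 → ℝ} {r t : ℝ≥0} (h : r < t) :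
    aliveBefore x f t ⊆ alive x f r :=
  fun _ hp u hu => hp u (hu.trans_lt h)

theorem alive_subset_aliveBefore {x : Ω → ℝ≥0 → ℝ} {f : ℝ≥0 → ℝ} {t : ℝ≥0} :
    alive x f t ⊆ aliveBefore x f t :=
  fun _ hp u hu => hp u hu.le

variable {mΩ : MeasurableSpace Ω} {P : Measure Ω} {x : Ω → ℝ≥0 → ℝ} {f : ℝ≥0 → ℝ}

theorem measurableSet_alive (hxc : ∀ ω, Continuous (x ω)) (hx : ∀ r, Measurable fun ω => x ω r)
    (hf : Monotone f) (hfr : ∀ t, ContinuousWithinAt f (Ici t) t) (t : ℝ≥0) :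
    MeasurableSet (alive x f t) :=
  measurableSet_forall_le (y := fun p : ℝ × Ω => p.1) (x := fun r p => x p.2 r)
    (f := fun r _ => f r) (fun p => hxc p.2) (fun _ => hf) (fun _ => hfr) measurable_fst
    (fun r _ => (hx r).comp measurable_snd) fun _ _ => measurable_const

theorem measurableSet_aliveBefore (hxc : ∀ ω, Continuous (x ω))
    (hx : ∀ r, Measurable fun ω => x ω r)
    (hf : Monotone f) (hfr : ∀ t, ContinuousWithinAt f (Ici t) t) (t : ℝ≥0) :
    MeasurableSet (aliveBefore x f t) :=
  measurableSet_forall_lt (y := fun p : ℝ × Ω => p.1) (x := fun r p => x p.2 r)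
    (f := fun r _ => f r) (T := fun _ => t) (fun p => hxc p.2) (fun _ => hf) (fun _ => hfr)
    measurable_fst (fun r _ => (hx r).comp measurable_snd) (fun _ _ => measurable_const)
    measurable_const fun _ => le_rfl

variable {μ : Measure (ℝ × Ω)} [IsFiniteMeasure μ]

theorem lawOn_alive_rightCts (hxc : ∀ ω, Continuous (x ω)) (hx : ∀ r, Measurable fun ω => x ω r)
    (hf : Monotone f) (hfr : ∀ t, ContinuousWithinAt f (Ici t) t) (t : ℝ≥0) :
    ContinuousWithinAt (fun r => lawOn μ (alive x f r) fun p => p.1 + x p.2 r) (Ici t) t := by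
  refine tendsto_lawOn (fun r => measurableSet_alive hxc hx hf hfr r)
    (measurableSet_alive hxc hx hf hfr t)
    (fun r => measurable_fst.add ((hx r).comp measurable_snd))
    (measurable_fst.add ((hx t).comp measurable_snd)) (fun p hp => ?_) (fun p hp => ?_) fun p => ?_
  · obtain ⟨u, htu, hu⟩ := exists_gt_forall_le_of_forall_le (hxc p.2) hf hfr hp
    filter_upwards [nhdsWithin_le_nhds (Iio_mem_nhds htu)] with r hr v hv
    exact hu v (hv.trans_lt hr)
  · filter_upwards [self_mem_nhdsWithin] with r hr h
    exact hp (alive_anti hr h)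
  · exact (tendsto_const_nhds.add ((hxc p.2).tendsto t)).mono_left nhdsWithin_le_nhds

theorem tendsto_lawOn_aliveBefore (hxc : ∀ ω, Continuous (x ω))
    (hx : ∀ r, Measurable fun ω => x ω r)
    (hf : Monotone f) (hfr : ∀ t, ContinuousWithinAt f (Ici t) t) (t : ℝ≥0) :
    Tendsto (fun r => lawOn μ (alive x f r) fun p => p.1 + x p.2 r) (𝓝[<] t)
      (𝓝 (lawOn μ (aliveBefore x f t) fun p => p.1 + x p.2 t)) := by
  refine tendsto_lawOn (fun r => measurableSet_alive hxc hx hf hfr r)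
    (measurableSet_aliveBefore hxc hx hf hfr t)
    (fun r => measurable_fst.add ((hx r).comp measurable_snd))
    (measurable_fst.add ((hx t).comp measurable_snd)) (fun p hp => ?_) (fun p hp => ?_) fun p => ?_
  · filter_upwards [self_mem_nhdsWithin] with r hr
    exact aliveBefore_subset_alive hr hp
  · have hp' : ∃ r < t, p.1 + x p.2 r ≤ f r := by simpa [aliveBefore] using hp
    obtain ⟨u, hu, hle⟩ := hp'
    filter_upwards [nhdsWithin_le_nhds (Ioi_mem_nhds hu)] with r hr h
    exact absurd (h u (le_of_lt hr)) (not_lt.2 hle)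
  · exact (tendsto_const_nhds.add ((hxc p.2).tendsto t)).mono_left nhdsWithin_le_nhds

/-- The increment of the noise after time `t` is independent of the survivors at time `t`, so it can
be integrated against the law of their positions. -/
theorem measure_aliveBefore_inter_eq_lintegral [IsProbabilityMeasure P] {μ₀ : Measure ℝ}
    [IsFiniteMeasure μ₀] {b : ℝ≥0 → Ω → ℝ} {w : ℝ≥0 → ℝ} {σ : ℝ} (hb : ∀ r, Measurable (b r))
    (hbc : ∀ ω, Continuous fun r => b r ω) (hw : Continuous w)
    (hf : Monotone f) (hfr : ∀ t, ContinuousWithinAt f (Ici t) t) {t u : ℝ≥0}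
    (hind : Indep (⨆ r ≤ t, MeasurableSpace.comap (b r) inferInstance)
      (MeasurableSpace.comap (fun ω => b u ω - b t ω) inferInstance) P)
    {m : ℝ → ℝ} (hm : Measurable m) :
    (μ₀.prod P) (aliveBefore (fun ω r => σ * b r ω + w r) f t ∩
      {p | p.1 + (σ * b t p.2 + w t) ≤ m (b u p.2 - b t p.2)}) =
    ∫⁻ ω, (lawOn (μ₀.prod P) (aliveBefore (fun ω r => σ * b r ω + w r) f t)
      (fun p => p.1 + (σ * b t p.2 + w t)) : Measure ℝ) (Iic (m (b u ω - b t ω))) ∂P := by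
  set x : Ω → ℝ≥0 → ℝ := fun ω r => σ * b r ω + w r with hx_def
  have hxc : ∀ ω, Continuous (x ω) := fun ω => (continuous_const.mul (hbc ω)).add hw
  have hx : ∀ r, Measurable fun ω => x ω r := fun r => ((hb r).const_mul σ).add_const _
  have hA := measurableSet_aliveBefore hxc hx hf hfr t
  have hXt : Measurable fun p : ℝ × Ω => p.1 + x p.2 t :=
    measurable_fst.add ((hx t).comp measurable_snd)
  have hΔ : Measurable fun ω => m (b u ω - b t ω) := hm.comp ((hb u).sub (hb t))
  -- the indicator of absorption, with separate scenarios for the past and for the increment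
  let g : (ℝ × Ω) → Ω → ℝ≥0∞ := fun p ω =>
    (aliveBefore x f t ∩ {p | p.1 + x p.2 t ≤ m (b u ω - b t ω)}).indicator 1 p
  have hg : Measurable (Function.uncurry g) := by
    have : MeasurableSet {z : (ℝ × Ω) × Ω | z.1 ∈ aliveBefore x f t ∧
        z.1.1 + x z.1.2 t ≤ m (b u z.2 - b t z.2)} :=
      (measurable_fst hA).inter
        (measurableSet_le (hXt.comp measurable_fst) (hΔ.comp measurable_snd))
    exact measurable_one.indicator this
  have hset : ∀ ω, MeasurableSet (aliveBefore x f t ∩ {p | p.1 + x p.2 t ≤ m (b u ω - b t ω)}) :=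
    fun ω => hA.inter (measurableSet_le hXt measurable_const)
  have hrhs : ∀ ω, (lawOn (μ₀.prod P) (aliveBefore x f t)
      (fun p => p.1 + x p.2 t) : Measure ℝ) (Iic (m (b u ω - b t ω))) =
      ∫⁻ p, g p ω ∂(μ₀.prod P) := fun ω => by
    rw [lawOn, FiniteMeasure.toMeasure_mk, Measure.map_apply hXt measurableSet_Iic,
      Measure.restrict_apply (hXt measurableSet_Iic), lintegral_indicator_one (hset ω), inter_comm]
    rfl
  have hm_le : (⨆ r ≤ t, MeasurableSpace.comap (b r) inferInstance) ≤ mΩ :=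
    iSup₂_le fun r _ => (hb r).comap_le
  have hH_le : MeasurableSpace.comap (fun ω => b u ω - b t ω) inferInstance ≤ mΩ :=
    ((hb u).sub (hb t)).comap_le
  have hdiag : ∀ y, ∫⁻ ω, g (y, ω) ω ∂P = ∫⁻ ω, ∫⁻ ω', g (y, ω) ω' ∂P ∂P := fun y => by
    refine lintegral_diag_of_indep hm_le hH_le hind (f := fun ω ω' => g (y, ω) ω') ?_
    have hbr : ∀ r ≤ t, Measurable[⨆ r ≤ t, MeasurableSpace.comap (b r) inferInstance] (b r) :=
      fun r hr => (comap_measurable (b r)).mono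
        (le_iSup₂ (f := fun r (_ : r ≤ t) => MeasurableSpace.comap (b r) inferInstance) r hr) le_rfl
    have hxr : ∀ r ≤ t, Measurable[⨆ r ≤ t, MeasurableSpace.comap (b r) inferInstance]
        (fun ω => x ω r) := fun r hr => ((hbr r hr).const_mul σ).add_const _
    have hS : MeasurableSet[⨆ r ≤ t, MeasurableSpace.comap (b r) inferInstance]
        {ω | ∀ r < t, f r < y + x ω r} :=
      @measurableSet_forall_lt Ω (⨆ r ≤ t, MeasurableSpace.comap (b r) inferInstance)
        (fun _ => y) (fun r ω => x ω r) (fun r _ => f r) hxc (fun _ => hf) (fun _ => hfr) t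
        (@measurable_const _ _ _ _ _) hxr (fun _ _ => @measurable_const _ _ _ _ _) (fun _ => t)
        (@measurable_const _ _ _ _ _) fun _ => le_rfl
    have hD : Measurable[MeasurableSpace.comap (fun ω => b u ω - b t ω) inferInstance]
        (fun ω => m (b u ω - b t ω)) := hm.comp (comap_measurable _)
    generalize (⨆ r ≤ t, MeasurableSpace.comap (b r) inferInstance) = m₁ at hxr hS
    generalize MeasurableSpace.comap (fun ω => b u ω - b t ω) inferInstance = m₂ at hD
    have hfst : Measurable[m₁.prod m₂, m₁] (Prod.fst : Ω × Ω → Ω) := @measurable_fst _ _ m₁ m₂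
    have hsnd : Measurable[m₁.prod m₂, m₂] (Prod.snd : Ω × Ω → Ω) := @measurable_snd _ _ m₁ m₂
    have : MeasurableSet[m₁.prod m₂] {z : Ω × Ω | z.1 ∈ {ω | ∀ r < t, f r < y + x ω r} ∧
        y + x z.1 t ≤ m (b u z.2 - b t z.2)} :=
      (hfst hS).inter (measurableSet_le (((hxr t le_rfl).comp hfst).const_add y) (hD.comp hsnd))
    exact Measurable.indicator (m := m₁.prod m₂) (f := fun _ => 1)
      (@measurable_const _ _ _ _ _) this
  have hlhs : MeasurableSet (aliveBefore x f t ∩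
      {p | p.1 + x p.2 t ≤ m (b u p.2 - b t p.2)}) :=
    hA.inter (measurableSet_le hXt (hΔ.comp measurable_snd))
  calc (μ₀.prod P) (aliveBefore x f t ∩ {p | p.1 + x p.2 t ≤ m (b u p.2 - b t p.2)})
      = ∫⁻ p, g p p.2 ∂(μ₀.prod P) := by
        rw [← lintegral_indicator_one hlhs]
        rfl
    _ = ∫⁻ y, ∫⁻ ω, g (y, ω) ω ∂P ∂μ₀ :=
        lintegral_prod _ (hg.comp (measurable_id.prodMk measurable_snd)).aemeasurable
    _ = ∫⁻ y, ∫⁻ ω, ∫⁻ ω', g (y, ω) ω' ∂P ∂P ∂μ₀ := lintegral_congr hdiag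
    _ = ∫⁻ p, ∫⁻ ω', g p ω' ∂P ∂(μ₀.prod P) :=
        (lintegral_prod _ hg.lintegral_prod_right'.aemeasurable).symm
    _ = ∫⁻ ω', ∫⁻ p, g p ω' ∂(μ₀.prod P) ∂P := lintegral_lintegral_swap hg.aemeasurable
    _ = _ := (lintegral_congr hrhs).symm

/-- A front located at `L` just before time `t`, in front of which mass has density at least `c` up
to distance `q`, cannot move by less than `q` at time `t`, unless the common noise pushes the
particles away from it: for any later time `u` with `w u ≤ w t` and with small displacement, the
mass that is absorbed exceeds what the front can account for. -/
theorem false_of_slow_front [IsProbabilityMeasure P] {μ₀ : Measure ℝ}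
    [IsFiniteMeasure μ₀] {b : ℝ≥0 → Ω → ℝ} {w : ℝ≥0 → ℝ} {σ : ℝ} (hb : ∀ r, Measurable (b r))
    (hbc : ∀ ω, Continuous fun r => b r ω) (hw : Continuous w)
    (hf : Monotone f) (hfr : ∀ t, ContinuousWithinAt f (Ici t) t) {t u : ℝ≥0} (htu : t ≤ u)
    (hind : Indep (⨆ r ≤ t, MeasurableSpace.comap (b r) inferInstance)
      (MeasurableSpace.comap (fun ω => b u ω - b t ω) inferInstance) P)
    (hint : Integrable (fun ω => σ * (b u ω - b t ω)) P)
    (hsymm : P.map (fun ω => -(σ * (b u ω - b t ω))) = P.map fun ω => σ * (b u ω - b t ω))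
    (hpos : ∀ z, 0 < P {ω | z < σ * (b u ω - b t ω)})
    {c L q : ℝ} (hc : 0 < c) (hLt : L ≤ f t) (hq : f t - L < q)
    (hmass : (μ₀.prod P) (aliveBefore (fun ω r => σ * b r ω + w r) f t \
      alive (fun ω r => σ * b r ω + w r) f u) ≤ ENNReal.ofReal (c * (f u - L)))
    (hdens : ∀ y, 0 < y → y < q → ENNReal.ofReal (c * y) ≤
      (lawOn (μ₀.prod P) (aliveBefore (fun ω r => σ * b r ω + w r) f t)
        (fun p => p.1 + (σ * b t p.2 + w t)) : Measure ℝ) (Icc L (L + y)))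
    (hwu : w u ≤ w t) (hsmall : 2 * (f u - (w u - w t) - f t) < q - (f t - L)) : False := by
  set J := f t - L with hJ
  set a := f u - (w u - w t) - f t with ha
  set N : Ω → ℝ := fun ω => σ * (b u ω - b t ω) with hN
  have hJ0 : 0 ≤ J := sub_nonneg.2 hLt
  have hdens' : ∀ z, 0 ≤ z → ENNReal.ofReal (c * min z q) ≤
      (lawOn (μ₀.prod P) (aliveBefore (fun ω r => σ * b r ω + w r) f t)
        (fun p => p.1 + (σ * b t p.2 + w t)) : Measure ℝ) (Iic (L + z)) := by
    intro z hz
    rcases (le_min hz (hJ0.trans hq.le)).eq_or_lt with h0 | h0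
    · rw [← h0]
      simp
    · have hlim : Tendsto (fun y => ENNReal.ofReal (c * y)) (𝓝[<] (min z q))
          (𝓝 (ENNReal.ofReal (c * min z q))) :=
        ((ENNReal.continuous_ofReal.comp (continuous_const.mul continuous_id)).tendsto
          _).mono_left nhdsWithin_le_nhds
      refine le_of_tendsto hlim ?_
      filter_upwards [Ioo_mem_nhdsLT h0] with y hy
      refine (hdens y hy.1 (hy.2.trans_le (min_le_right _ _))).trans (measure_mono ?_)
      exact fun v hv => hv.2.trans (by linarith [hy.2.trans_le (min_le_left z q)])
  -- particles below `f t`, or brought below `f u` by the increments, are absorbed by time `u`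
  have hsub : aliveBefore (fun ω r => σ * b r ω + w r) f t ∩
      {p | p.1 + (σ * b t p.2 + w t) ≤ L + max J (J + a - σ * (b u p.2 - b t p.2))} ⊆
      aliveBefore (fun ω r => σ * b r ω + w r) f t \
        alive (fun ω r => σ * b r ω + w r) f u := by
    rintro p ⟨hp, hle⟩
    refine ⟨hp, fun hal => ?_⟩
    have h1 := hal t htu
    have h2 := hal u le_rfl
    rw [mem_ofPred_eq, ← sub_le_iff_le_add', le_max_iff] at hle
    rcases hle with hle | hle
    · linarith
    · linarith
  have hmeq := measure_aliveBefore_inter_eq_lintegral (P := P) (μ₀ := μ₀) (f := f) (σ := σ) hb hbc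
    hw hf hfr hind (m := fun z => L + max J (J + a - σ * z)) (by fun_prop)
  have hchain : ∫⁻ ω, ENNReal.ofReal (c * min (max J (J + a - N ω)) q) ∂P ≤
      ENNReal.ofReal (c * (f u - L)) := by
    refine le_trans ?_ ((measure_mono hsub).trans hmass)
    rw [hmeq]
    exact lintegral_mono fun ω => hdens' _ (hJ0.trans (le_max_left _ _))
  have hcl := lt_integral_clamp hint hsymm hpos hq hsmall
  have hclint : Integrable (fun ω => min (max J (J + a - N ω)) q) P :=
    (((integrable_const J).sup ((integrable_const (J + a)).sub hint))).inf (integrable_const q)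
  have hnn : 0 ≤ᵐ[P] fun ω => c * min (max J (J + a - N ω)) q :=
    Eventually.of_forall fun ω =>
      mul_nonneg hc.le (le_min (hJ0.trans (le_max_left _ _)) (hJ0.trans hq.le))
  rw [← ofReal_integral_eq_lintegral_ofReal (hclint.const_mul c) hnn, integral_const_mul] at hchain
  have hfu : f t ≤ f u := hf htu
  rw [ENNReal.ofReal_le_ofReal_iff (mul_nonneg hc.le (by linarith))] at hchain
  have := le_of_mul_le_mul_left hchain hc
  linarith

end Frozen

/-! ### Signs of increments after an optional time -/

section OptionalTime

variable {Ω : Type*} {mΩ : MeasurableSpace Ω} {P : Measure Ω}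

/-- The first point of the grid of mesh `1 / (k + 1)` strictly after `r`. -/
noncomputable def ceilGrid (k : ℕ) (r : ℝ≥0) : ℝ≥0 :=
  ((⌊((k : ℝ≥0) + 1) * r⌋₊ : ℝ≥0) + 1) / (k + 1)

theorem tendsto_ceilGrid (r : ℝ≥0) : Tendsto (fun k => ceilGrid k r) atTop (𝓝 r) := by
  have h1 : ∀ k : ℕ, r ≤ ceilGrid k r := fun k => by
    rw [ceilGrid, le_div_iff₀ (by positivity), mul_comm]
    exact (Nat.lt_floor_add_one _).le
  have h2 : ∀ k : ℕ, ceilGrid k r ≤ r + 1 / ((k : ℝ≥0) + 1) := fun k => by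
    rw [ceilGrid, add_div]
    gcongr
    rw [div_le_iff₀ (by positivity), mul_comm]
    exact Nat.floor_le zero_le
  have h3 : Tendsto (fun k : ℕ => r + 1 / ((k : ℝ≥0) + 1)) atTop (𝓝 r) := by
    simpa using tendsto_const_nhds.add (tendsto_one_div_add_atTop_nhds_zero_nat (𝕜 := ℝ≥0))
  exact tendsto_of_tendsto_of_tendsto_of_le_of_le tendsto_const_nhds h3 h1 h2

/-- If the increments of a continuous process after deterministic times are non-positive with
conditional probability at least `1 / 2`, then after an optional time `τ` they are non-positive
along a sequence of times decreasing to `τ` with conditional probability at least `1 / 2`. -/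
theorem half_le_measure_frequently_le [IsProbabilityMeasure P] {𝓕 : ℝ≥0 → MeasurableSpace Ω}
    (hmono : Monotone 𝓕) (h𝓕 : ∀ t, 𝓕 t ≤ mΩ) {Z : ℝ≥0 → Ω → ℝ} (hZ : ∀ t, Measurable (Z t))
    (hZc : ∀ ω, Continuous fun t => Z t ω)
    (hsign : ∀ t h A, MeasurableSet[𝓕 t] A → P A / 2 ≤ P (A ∩ {ω | Z (t + h) ω ≤ Z t ω}))
    {τ : Ω → ℝ≥0} {A : Set Ω} (hA : ∀ r, MeasurableSet[𝓕 r] (A ∩ {ω | τ ω < r})) :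
    P A / 2 ≤ P (A ∩ {ω | ∃ᶠ n : ℕ in atTop, Z (τ ω + 1 / ((n : ℝ≥0) + 1)) ω ≤ Z (τ ω) ω}) := by
  -- the part of `A` on which the discretised time is a given grid point
  let C : ℕ → ℕ → Set Ω := fun k j => A ∩ {ω | ⌊((k : ℝ≥0) + 1) * τ ω⌋₊ = j}
  let g : ℕ → ℕ → ℝ≥0 := fun k j => ((j : ℝ≥0) + 1) / ((k : ℝ≥0) + 1)
  have hC : ∀ k j, MeasurableSet[𝓕 (g k j)] (C k j) := by
    intro k j
    have hk : (0 : ℝ≥0) < (k : ℝ≥0) + 1 := by positivity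
    have : C k j = (A ∩ {ω | τ ω < g k j}) \
        (A ∩ {ω | τ ω < (j : ℝ≥0) / ((k : ℝ≥0) + 1)}) := by
      ext ω
      have hfl := Nat.floor_eq_iff (zero_le : 0 ≤ ((k : ℝ≥0) + 1) * τ ω) (n := j)
      simp only [C, g, mem_inter_iff, mem_ofPred_eq, Set.mem_sdiff, lt_div_iff₀ hk, hfl,
        mul_comm (τ ω)]
      constructor
      · rintro ⟨h1, h2, h3⟩
        exact ⟨⟨h1, h3⟩, fun h => absurd h.2 (not_lt.2 h2)⟩
      · rintro ⟨⟨h1, h2⟩, h3⟩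
        exact ⟨h1, not_lt.1 fun h => h3 ⟨h1, h⟩, h2⟩
    have hle : (j : ℝ≥0) / ((k : ℝ≥0) + 1) ≤ g k j := by
      simp only [g]
      gcongr
      simp
    rw [this]
    exact @MeasurableSet.diff _ (𝓕 (g k j)) _ _ (hA _) (hmono hle _ (hA _))
  have hC' : ∀ k j, MeasurableSet (C k j) := fun k j => h𝓕 _ _ (hC k j)
  have hdisj : ∀ k, Pairwise (Function.onFun Disjoint (C k)) := fun k i j hij =>
    disjoint_left.2 fun ω hi hj => hij (hi.2.symm.trans hj.2)
  have hAC : ∀ k, A = ⋃ j, C k j := fun k => by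
    ext ω
    simp [C]
  have hAm : MeasurableSet A := by
    rw [hAC 0]
    exact MeasurableSet.iUnion (hC' 0)
  -- the increment of length `1 / (n + 1)` after the discretised time is non-positive; the mesh goes
  -- to zero for fixed `n`, and only then `n` to infinity
  let E : ℕ → ℕ → Set Ω := fun n k => ⋃ j, (C k j ∩
    {ω | Z (g k j + 1 / ((n : ℝ≥0) + 1)) ω ≤ Z (g k j) ω})
  have hEm' : ∀ n k j, MeasurableSet (C k j ∩
      {ω | Z (g k j + 1 / ((n : ℝ≥0) + 1)) ω ≤ Z (g k j) ω}) := fun n k j =>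
    (hC' k j).inter (measurableSet_le (hZ _) (hZ _))
  have hEm : ∀ n k, MeasurableSet (E n k) := fun n k => MeasurableSet.iUnion (hEm' n k)
  have hEP : ∀ n k, P A / 2 ≤ P (E n k) := by
    intro n k
    rw [measure_iUnion (fun i j hij => (hdisj k hij).mono inter_subset_left inter_subset_left)
      (hEm' n k), hAC k, measure_iUnion (hdisj k) (hC' k), ENNReal.div_eq_inv_mul,
      ← ENNReal.tsum_mul_left]
    exact ENNReal.tsum_le_tsum fun j => by
      rw [← ENNReal.div_eq_inv_mul]
      exact hsign _ _ _ (hC k j)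
  have hlim1 : ∀ n, P A / 2 ≤ P {ω | ∃ᶠ k in atTop, ω ∈ E n k} := fun n =>
    le_measure_frequently (hEm n) (hEP n)
  have hE2m : ∀ n, MeasurableSet {ω | ∃ᶠ k in atTop, ω ∈ E n k} := fun n => by
    have : {ω | ∃ᶠ k in atTop, ω ∈ E n k} = limsup (E n) atTop := by
      rw [limsup_eq_iInf_iSup_of_nat]
      ext ω
      simp [frequently_atTop]
    rw [this]
    exact MeasurableSet.measurableSet_limsup (hEm n)
  refine (le_measure_frequently hE2m hlim1).trans (measure_mono fun ω hω => ?_)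
  have hmemA : ω ∈ A := by
    obtain ⟨n, hn⟩ := hω.exists
    obtain ⟨k, hk⟩ := Frequently.exists hn
    obtain ⟨j, hj⟩ := mem_iUnion.1 hk
    exact hj.1.1
  refine ⟨hmemA, Frequently.mono hω fun n hn => ?_⟩
  have hfreq : ∃ᶠ k in atTop, Z (ceilGrid k (τ ω) + 1 / ((n : ℝ≥0) + 1)) ω -
      Z (ceilGrid k (τ ω)) ω ≤ 0 := Frequently.mono hn fun k hk => by
    obtain ⟨j, hj, hle⟩ := mem_iUnion.1 hk
    have : ceilGrid k (τ ω) = g k j := by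
      simp only [ceilGrid, g]
      rw [hj.2]
    rw [this]
    exact sub_nonpos.2 hle
  have hcont : Tendsto (fun k => Z (ceilGrid k (τ ω) + 1 / ((n : ℝ≥0) + 1)) ω -
      Z (ceilGrid k (τ ω)) ω) atTop (𝓝 (Z (τ ω + 1 / ((n : ℝ≥0) + 1)) ω - Z (τ ω) ω)) := by
    have h1 := (hZc ω).tendsto (τ ω + 1 / ((n : ℝ≥0) + 1))
    exact (h1.comp ((tendsto_ceilGrid (τ ω)).add_const _)).sub
      (((hZc ω).tendsto (τ ω)).comp (tendsto_ceilGrid (τ ω)))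
  exact sub_nonpos.1 (le_of_tendsto_of_frequently hcont hfreq)

end OptionalTime

/-! ### Random environments and conditional masses -/

section Environment

open TopologicalSpace

/-- Fubini's theorem for the mass that the kernel `ν₀`, restricted to the half-lines to the right of
`s₀`, gives to the sections of a measurable set. -/
theorem measurable_prod_section {α β : Type*} [MeasurableSpace α] [MeasurableSpace β]
    (P : Measure β) [SFinite P] {s₀ : α → ℝ} (hs₀ : Measurable s₀) {ν₀ : α → Measure ℝ}
    (hν₀ : Measurable ν₀) [∀ a, IsFiniteMeasure (ν₀ a)] {S : Set ((α × β) × ℝ)}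
    (hS : MeasurableSet S) :
    Measurable (fun z : α × β => ν₀ z.1 {y | s₀ z.1 ≤ y ∧ (z, y) ∈ S}) ∧
    (∀ a, (((ν₀ a).restrict (Ici (s₀ a))).prod P) {p | ((a, p.2), p.1) ∈ S} =
      ∫⁻ b, ν₀ a {y | s₀ a ≤ y ∧ ((a, b), y) ∈ S} ∂P) ∧
    Measurable fun a => (((ν₀ a).restrict (Ici (s₀ a))).prod P) {p | ((a, p.2), p.1) ∈ S} := by
  have h1 : Measurable (fun z : α × β => ν₀ z.1 {y | s₀ z.1 ≤ y ∧ (z, y) ∈ S}) := by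
    let k : Kernel (α × β) ℝ := ⟨fun z => ν₀ z.1, hν₀.comp measurable_fst⟩
    have hm : MeasurableSet {v : (α × β) × ℝ | s₀ v.1.1 ≤ v.2 ∧ v ∈ S} :=
      (measurableSet_le (hs₀.comp (measurable_fst.comp measurable_fst)) measurable_snd).inter hS
    exact Kernel.measurable_kernel_prodMk_left_of_finite (κ := k) hm
      fun z => inferInstanceAs (IsFiniteMeasure (ν₀ z.1))
  have h2 : ∀ a, (((ν₀ a).restrict (Ici (s₀ a))).prod P) {p | ((a, p.2), p.1) ∈ S} =
      ∫⁻ b, ν₀ a {y | s₀ a ≤ y ∧ ((a, b), y) ∈ S} ∂P := fun a => by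
    have hm : MeasurableSet {p : ℝ × β | ((a, p.2), p.1) ∈ S} :=
      ((measurable_const.prodMk measurable_snd).prodMk measurable_fst) hS
    rw [Measure.prod_apply_symm hm]
    refine lintegral_congr fun b => ?_
    have hm' : MeasurableSet ((fun y : ℝ => (y, b)) ⁻¹' {p : ℝ × β | ((a, p.2), p.1) ∈ S}) :=
      measurable_prodMk_right hm
    rw [Measure.restrict_apply hm', inter_comm]
    rfl
  refine ⟨h1, h2, ?_⟩
  simp only [h2]
  exact h1.lintegral_prod_right'

variable {Ω : Type*} {mΩ : MeasurableSpace Ω}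

/-- The noise `σ B + θ W` of a particle, with the idiosyncratic part `B` and the common part `W`
taken from separate scenarios `ω'` and `ω`. -/
def noise (σ θ : ℝ) (b w : ℝ≥0 → Ω → ℝ) (ω ω' : Ω) (r : ℝ≥0) : ℝ := σ * b r ω' + θ * w r ω

/-- The joint law of the starting point of a particle and of the scenario driving its idiosyncratic
noise, given the environment `ω`. -/
noncomputable def initLaw (P : Measure Ω) (s₀ : Ω → ℝ) (ν₀ : Ω → Measure ℝ) (ω : Ω) :
    Measure (ℝ × Ω) :=
  ((ν₀ ω).restrict (Ici (s₀ ω))).prod P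

instance (P : Measure Ω) [IsProbabilityMeasure P] (s₀ : Ω → ℝ) (ν₀ : Ω → Measure ℝ)
    [∀ ω, IsFiniteMeasure (ν₀ ω)] (ω : Ω) : IsFiniteMeasure (initLaw P s₀ ν₀ ω) := by
  unfold initLaw
  infer_instance

/-- The position of the front just before time `t`; just before time `0` this is `s₀`. -/
noncomputable def frontBefore (s₀ : Ω → ℝ) (s : ℝ≥0 → Ω → ℝ) (t : ℝ≥0) (ω : Ω) : ℝ :=
  if t = 0 then s₀ ω else Function.leftLim (fun r => s r ω) t

/-- The conditional mass is computed by freezing the scenario in its dependence on `m` and averaging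
over an independent copy of the scenario in its dependence on `H`. -/
theorem condMass_ae_eq {P : Measure Ω} [IsProbabilityMeasure P] {s₀ : Ω → ℝ}
    {ν₀ : Ω → Measure ℝ} [∀ ω, IsFiniteMeasure (ν₀ ω)] {m H : MeasurableSpace Ω}
    (hm : m ≤ mΩ) (hH : H ≤ mΩ) (hi : Indep m H P) (hs₀ : Measurable[m] s₀)
    (hν₀ : Measurable[m] ν₀) {E : ℝ → Set Ω} {S : Set ((Ω × Ω) × ℝ)}
    (hS : MeasurableSet[(m.prod H).prod inferInstance] S)
    (hES : ∀ᵐ ω ∂P, ∀ y, ω ∈ E y ↔ ((ω, ω), y) ∈ S) :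
    condMass P m s₀ ν₀ E =ᵐ[P] fun ω => initLaw P s₀ ν₀ ω {p | ((ω, p.2), p.1) ∈ S} := by
  have h1 := (@measurable_prod_section Ω Ω m H (P.trim hH) _ s₀ hs₀ ν₀ hν₀ _ S hS).1
  have hS' : MeasurableSet[(mΩ.prod mΩ).prod inferInstance] S :=
    (sup_le_sup (MeasurableSpace.comap_mono (sup_le_sup (MeasurableSpace.comap_mono hm)
      (MeasurableSpace.comap_mono hH))) le_rfl :
        (m.prod H).prod inferInstance ≤ (mΩ.prod mΩ).prod inferInstance) _ hS
  have h2 := (@measurable_prod_section Ω Ω mΩ mΩ P _ s₀ (hs₀.mono hm le_rfl) ν₀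
    (hν₀.mono hm le_rfl) _ S hS').2.1
  have h3 : (fun ω => ν₀ ω {y | s₀ ω ≤ y ∧ ω ∈ E y}) =ᵐ[P]
      fun ω => ν₀ ω {y | s₀ ω ≤ y ∧ ((ω, ω), y) ∈ S} := by
    filter_upwards [hES] with ω hω
    simp only [hω]
  refine (condLExp_congr_ae h3).trans ((condLExp_diag_of_indep hm hH hi
    (f := fun ω ω' => ν₀ ω {y | s₀ ω ≤ y ∧ ((ω, ω'), y) ∈ S}) h1).trans ?_)
  exact Eventually.of_forall fun ω => (h2 ω).symm

section RandomTime

variable {α β : Type*} [MeasurableSpace α] [MeasurableSpace β] {s₀ : α → ℝ}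
  {w s : ℝ≥0 → α → ℝ} {b : ℝ≥0 → β → ℝ} {σ θ : ℝ} {t : ℝ≥0}

theorem measurableSet_survival (hwc : ∀ a, Continuous fun r => w r a)
    (hbc : ∀ a, Continuous fun r => b r a) (hsm : ∀ a, Monotone fun r => s r a)
    (hsr : ∀ a t, ContinuousWithinAt (fun r => s r a) (Ici t) t)
    (hw : ∀ r ≤ t, Measurable (w r)) (hs : ∀ r ≤ t, Measurable (s r))
    (hb : ∀ r, Measurable (b r)) :
    MeasurableSet {z : (α × β) × ℝ |
      ∀ r ≤ t, s r z.1.1 < z.2 + (σ * b r z.1.2 + θ * w r z.1.1)} :=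
  measurableSet_forall_le (y := fun z : (α × β) × ℝ => z.2)
    (x := fun r z => σ * b r z.1.2 + θ * w r z.1.1) (f := fun r z => s r z.1.1)
    (fun _ => (continuous_const.mul (hbc _)).add (continuous_const.mul (hwc _)))
    (fun _ => hsm _) (fun _ => hsr _) measurable_snd
    (fun r hr => (((hb r).comp (measurable_snd.comp measurable_fst)).const_mul σ).add
      (((hw r hr).comp (measurable_fst.comp measurable_fst)).const_mul θ))
    (fun r hr => (hs r hr).comp (measurable_fst.comp measurable_fst))

theorem measurable_frontBefore (hs₀ : Measurable s₀) (hsm : ∀ a, Monotone fun r => s r a)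
    (hs : ∀ r ≤ t, Measurable (s r)) {T : α → ℝ≥0} (hT : Measurable T) (hTt : ∀ a, T a ≤ t) :
    Measurable fun a => frontBefore s₀ s (T a) a := by
  refine measurable_of_Ioi fun c => ?_
  have : (fun a => frontBefore s₀ s (T a) a) ⁻¹' Ioi c = ({a | T a = 0} ∩ {a | c < s₀ a}) ∪
      ⋃ i : ℕ, {a | denseSeq ℝ≥0 i < T a} ∩ {a | c < s (min (denseSeq ℝ≥0 i) t) a} := by
    ext a
    simp only [mem_preimage, mem_Ioi, mem_union, mem_iUnion, mem_inter_iff, mem_ofPred_eq,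
      frontBefore]
    split_ifs with h0
    · simp [h0]
    · simp only [h0, false_and, false_or]
      constructor
      · intro h
        have hpos : 0 < T a := pos_iff_ne_zero.2 h0
        have h1 : ∀ᶠ r in 𝓝[<] T a, c < s r a := ((hsm a).tendsto_leftLim (T a)) (lt_mem_nhds h)
        obtain ⟨u, hu, hu'⟩ := (mem_nhdsLT_iff_exists_Ioo_subset' hpos).1 h1
        obtain ⟨i, hi⟩ := (denseRange_denseSeq ℝ≥0).exists_mem_open isOpen_Ioo (nonempty_Ioo.2 hu)
        refine ⟨i, hi.2, ?_⟩
        rw [min_eq_left (hi.2.le.trans (hTt a))]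
        exact hu' hi
      · rintro ⟨i, hi, h⟩
        rw [min_eq_left (hi.le.trans (hTt a))] at h
        exact h.trans_le ((hsm a).le_leftLim hi)
  rw [this]
  exact ((hT (measurableSet_singleton 0)).inter (measurableSet_lt measurable_const hs₀)).union
    (MeasurableSet.iUnion fun i => (measurableSet_lt measurable_const hT).inter
      (measurableSet_lt measurable_const (hs _ (min_le_right _ _))))

/-- The mass in front of the front just before a random time is a random variable. -/
theorem measurable_lawOn_aliveBefore {P : Measure β} [IsProbabilityMeasure P]
    {ν₀ : α → Measure ℝ} [∀ a, IsFiniteMeasure (ν₀ a)]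
    (hs₀ : Measurable s₀) (hν₀ : Measurable ν₀) (hwc : ∀ a, Continuous fun r => w r a)
    (hbc : ∀ a, Continuous fun r => b r a) (hsm : ∀ a, Monotone fun r => s r a)
    (hsr : ∀ a t, ContinuousWithinAt (fun r => s r a) (Ici t) t)
    (hw : ∀ r ≤ t, Measurable (w r)) (hs : ∀ r ≤ t, Measurable (s r))
    (hb : ∀ r, Measurable (b r)) {T : α → ℝ≥0} (hT : Measurable T) (hTt : ∀ a, T a ≤ t)
    {L : α → ℝ} (hL : Measurable L) (y : ℝ) :
    Measurable fun a => (lawOn (((ν₀ a).restrict (Ici (s₀ a))).prod P)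
      (aliveBefore (fun b' r => σ * b r b' + θ * w r a) (fun r => s r a) (T a))
      (fun p => p.1 + (σ * b (T a) p.2 + θ * w (T a) a)) : Measure ℝ) (Icc (L a) (L a + y)) := by
  have hx : Measurable fun z : (α × β) × ℝ =>
      z.2 + (σ * b (T z.1.1) z.1.2 + θ * w (T z.1.1) z.1.1) := by
    have h1 : Measurable fun z : α × β => b (T z.1) z.2 :=
      measurable_eval_of_continuous (x := fun r (z : α × β) => b r z.2) (fun z => hbc z.2)
        (fun r _ => (hb r).comp measurable_snd) (hT.comp measurable_fst) fun z => hTt z.1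
    have h2 : Measurable fun a => w (T a) a := measurable_eval_of_continuous hwc hw hT hTt
    exact measurable_snd.add (((h1.comp measurable_fst).const_mul σ).add
      ((h2.comp (measurable_fst.comp measurable_fst)).const_mul θ))
  have hS : MeasurableSet {z : (α × β) × ℝ | ∀ r < T z.1.1,
      s r z.1.1 < z.2 + (σ * b r z.1.2 + θ * w r z.1.1)} :=
    measurableSet_forall_lt (y := fun z : (α × β) × ℝ => z.2)
      (x := fun r z => σ * b r z.1.2 + θ * w r z.1.1) (f := fun r z => s r z.1.1)
      (T := fun z => T z.1.1)
      (fun _ => (continuous_const.mul (hbc _)).add (continuous_const.mul (hwc _)))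
      (fun _ => hsm _) (fun _ => hsr _) measurable_snd
      (fun r hr => (((hb r).comp (measurable_snd.comp measurable_fst)).const_mul σ).add
        (((hw r hr).comp (measurable_fst.comp measurable_fst)).const_mul θ))
      (fun r hr => (hs r hr).comp (measurable_fst.comp measurable_fst))
      (hT.comp (measurable_fst.comp measurable_fst)) fun _ => hTt _
  have hLz : Measurable fun z : (α × β) × ℝ => L z.1.1 :=
    hL.comp (measurable_fst.comp measurable_fst)
  have hI : MeasurableSet {z : (α × β) × ℝ |
      z.2 + (σ * b (T z.1.1) z.1.2 + θ * w (T z.1.1) z.1.1) ∈ Icc (L z.1.1) (L z.1.1 + y)} :=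
    (measurableSet_le hLz hx).inter (measurableSet_le hx (hLz.add_const y))
  have key := (measurable_prod_section P hs₀ hν₀ (hI.inter hS)).2.2
  convert key using 2 with a
  have hXa : Measurable fun p : ℝ × β => p.1 + (σ * b (T a) p.2 + θ * w (T a) a) :=
    measurable_fst.add ((((hb _).comp measurable_snd).const_mul σ).add_const _)
  rw [lawOn, FiniteMeasure.toMeasure_mk, Measure.map_apply hXa measurableSet_Icc,
    Measure.restrict_apply (hXa measurableSet_Icc)]
  rfl

end RandomTime

end Environment

/-! ### Absorbed mass and position of the front -/

section Model

open TopologicalSpace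

theorem exists_denseSeq_gt {u : ℝ≥0} {p : ℝ≥0 → Prop} (h : ∀ᶠ r in 𝓝[≥] u, p r) :
    ∃ i, u < denseSeq ℝ≥0 i ∧ p (denseSeq ℝ≥0 i) := by
  obtain ⟨v, hv, hv'⟩ := (mem_nhdsGE_iff_exists_Ico_subset' (show u < u + 1 by simp)).1 h
  obtain ⟨i, hi⟩ := (denseRange_denseSeq ℝ≥0).exists_mem_open isOpen_Ioo (nonempty_Ioo.2 hv)
  exact ⟨i, hi.1, hv' ⟨hi.1.le, hi.2⟩⟩

theorem exists_denseSeq_lt {u : ℝ≥0} (hu : 0 < u) {p : ℝ≥0 → Prop} (h : ∀ᶠ r in 𝓝[<] u, p r) :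
    ∃ i, denseSeq ℝ≥0 i < u ∧ p (denseSeq ℝ≥0 i) := by
  obtain ⟨v, hv, hv'⟩ := (mem_nhdsLT_iff_exists_Ioo_subset' hu).1 h
  obtain ⟨i, hi⟩ := (denseRange_denseSeq ℝ≥0).exists_mem_open isOpen_Ioo (nonempty_Ioo.2 hv)
  exact ⟨i, hi.2, hv' hi⟩

/-- Two right-continuous functions that agree on a dense sequence of times are equal. -/
theorem eq_of_rightCts_of_denseSeq {X : Type*} [TopologicalSpace X] [T2Space X] {g h : ℝ≥0 → X}
    (hg : ∀ t, ContinuousWithinAt g (Ici t) t) (hh : ∀ t, ContinuousWithinAt h (Ici t) t)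
    (heq : ∀ i, g (denseSeq ℝ≥0 i) = h (denseSeq ℝ≥0 i)) : g = h := by
  funext t
  by_contra hne
  obtain ⟨U, V, hU, hV, hgU, hhV, hUV⟩ := t2_separation hne
  obtain ⟨i, -, h1, h2⟩ := exists_denseSeq_gt
    (((hg t).eventually (hU.mem_nhds hgU)).and ((hh t).eventually (hV.mem_nhds hhV)))
  exact disjoint_left.1 hUV h1 (heq i ▸ h2)

variable {Ω : Type*}

theorem frontBefore_le {s₀ : Ω → ℝ} {s : ℝ≥0 → Ω → ℝ} {ω : Ω} (hsm : Monotone fun r => s r ω)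
    (h0 : s₀ ω ≤ s 0 ω) (t : ℝ≥0) : frontBefore s₀ s t ω ≤ s t ω := by
  unfold frontBefore
  split_ifs with ht
  · rwa [ht]
  · exact hsm.leftLim_le le_rfl

theorem le_frontBefore {s₀ : Ω → ℝ} {s : ℝ≥0 → Ω → ℝ} {ω : Ω} (hsm : Monotone fun r => s r ω)
    (h0 : s₀ ω ≤ s 0 ω) (t : ℝ≥0) : s₀ ω ≤ frontBefore s₀ s t ω := by
  unfold frontBefore
  split_ifs with ht
  · exact le_rfl
  · exact h0.trans (hsm.le_leftLim (pos_iff_ne_zero.2 ht))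

variable {H mΩ : MeasurableSpace Ω}

/-- If the mass absorbed up to each time of a dense sequence is proportional to the displacement of
the front, then between a time `t-` and a time `u ≥ t` at most the mass accounted for by the
displacement of the front is absorbed. -/
theorem measure_aliveBefore_diff_alive_le {μ : Measure (ℝ × Ω)} [IsFiniteMeasure μ]
    {x : Ω → ℝ≥0 → ℝ} {s₀ : Ω → ℝ} {s : ℝ≥0 → Ω → ℝ} {ω : Ω} {c : ℝ} (hc : 0 < c)
    (hxc : ∀ ω', Continuous (x ω')) (hx : ∀ r, Measurable fun ω' => x ω' r)
    (hsm : Monotone fun r => s r ω) (hsr : ∀ t, ContinuousWithinAt (fun r => s r ω) (Ici t) t)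
    (h0 : s₀ ω ≤ s 0 ω)
    (hD : ∀ i, μ (alive x (fun r => s r ω) (denseSeq ℝ≥0 i))ᶜ =
      ENNReal.ofReal (c * (s (denseSeq ℝ≥0 i) ω - s₀ ω))) {t u : ℝ≥0} (htu : t ≤ u) :
    μ (aliveBefore x (fun r => s r ω) t \ alive x (fun r => s r ω) u) ≤
      ENNReal.ofReal (c * (s u ω - frontBefore s₀ s t ω)) := by
  have hup : μ (alive x (fun r => s r ω) u)ᶜ ≤ ENNReal.ofReal (c * (s u ω - s₀ ω)) := by
    by_contra! hlt
    have hcont : ContinuousWithinAt (fun r => ENNReal.ofReal (c * (s r ω - s₀ ω))) (Ici u) u :=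
      ENNReal.continuous_ofReal.continuousAt.comp_continuousWithinAt
        (((hsr u).sub continuousWithinAt_const).const_mul c)
    obtain ⟨i, hi, h⟩ := exists_denseSeq_gt (hcont.eventually (gt_mem_nhds hlt))
    rw [← hD i] at h
    exact absurd (measure_mono (compl_subset_compl.2 (alive_anti hi.le))) (not_le.2 h)
  have hlow : ENNReal.ofReal (c * (frontBefore s₀ s t ω - s₀ ω)) ≤
      μ (aliveBefore x (fun r => s r ω) t)ᶜ := by
    by_cases ht : t = 0
    · simp [frontBefore, ht]
    · by_contra! hlt
      have hcont : Tendsto (fun r => ENNReal.ofReal (c * (s r ω - s₀ ω))) (𝓝[<] t)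
          (𝓝 (ENNReal.ofReal (c * (frontBefore s₀ s t ω - s₀ ω)))) := by
        rw [frontBefore, if_neg ht]
        exact (ENNReal.continuous_ofReal.tendsto _).comp
          (((hsm.tendsto_leftLim t).sub tendsto_const_nhds).const_mul c)
      obtain ⟨i, hi, h⟩ := exists_denseSeq_lt (pos_iff_ne_zero.2 ht)
        (hcont.eventually (lt_mem_nhds hlt))
      rw [← hD i] at h
      exact absurd (measure_mono (compl_subset_compl.2 (aliveBefore_subset_alive hi)))
        (not_le.2 h)
  have hL := le_frontBefore hsm h0 t
  have hset : aliveBefore x (fun r => s r ω) t \ alive x (fun r => s r ω) u =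
      (alive x (fun r => s r ω) u)ᶜ \ (aliveBefore x (fun r => s r ω) t)ᶜ := by
    ext p
    simp only [Set.mem_sdiff, mem_compl_iff, not_not]
    exact and_comm
  rw [hset, measure_sdiff (compl_subset_compl.2
    ((alive_anti htu).trans alive_subset_aliveBefore))
    (measurableSet_aliveBefore hxc hx hsm hsr t).compl.nullMeasurableSet (measure_ne_top _ _)]
  refine (tsub_le_tsub hup hlow).trans (le_of_eq ?_)
  rw [← ENNReal.ofReal_sub _ (mul_nonneg hc.le (sub_nonneg.2 hL))]
  congr 1
  ring

/-- The data of the problem after modification on null sets: the noises `b` and `w` have continuous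
paths, the common noise `w`, the front `s`, `s₀` and `ν₀` are adapted to `𝓕`, and the idiosyncratic
noise `b` is measurable with respect to a σ-algebra `H` independent of `𝓕`. -/
structure IsEnvironment (P : Measure Ω) (𝓕 : Filtration ℝ≥0 mΩ) (H : MeasurableSpace Ω)
    (b w : ℝ≥0 → Ω → ℝ) (s₀ : Ω → ℝ) (ν₀ : Ω → Measure ℝ) (s : ℝ≥0 → Ω → ℝ) : Prop where
  b_cont : ∀ ω, Continuous fun t => b t ω
  w_cont : ∀ ω, Continuous fun t => w t ω
  s_mono : ∀ ω, Monotone fun t => s t ω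
  s_rightCts : ∀ ω t, ContinuousWithinAt (fun r => s r ω) (Ici t) t
  s_adapted : ∀ t, Measurable[𝓕 t] (s t)
  w_adapted : ∀ t, Measurable[𝓕 t] (w t)
  s₀_meas : Measurable[𝓕 0] s₀
  ν₀_meas : Measurable[𝓕 0] ν₀
  H_le : H ≤ mΩ
  b_meas : ∀ t, Measurable[H] (b t)
  indep : Indep (⨆ r, 𝓕 r) H P

variable {P : Measure Ω} [IsProbabilityMeasure P] {𝓕 : Filtration ℝ≥0 mΩ}
  {b w : ℝ≥0 → Ω → ℝ} {s₀ : Ω → ℝ} {ν₀ : Ω → Measure ℝ}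
  [∀ ω, IsFiniteMeasure (ν₀ ω)] {s : ℝ≥0 → Ω → ℝ}

namespace IsEnvironment

omit [IsProbabilityMeasure P] [∀ ω, IsFiniteMeasure (ν₀ ω)] in
theorem noise_cont (h : IsEnvironment P 𝓕 H b w s₀ ν₀ s) (σ θ : ℝ) (ω ω' : Ω) :
    Continuous (noise σ θ b w ω ω') :=
  (continuous_const.mul (h.b_cont ω')).add (continuous_const.mul (h.w_cont ω))

omit [IsProbabilityMeasure P] [∀ ω, IsFiniteMeasure (ν₀ ω)] in
theorem measurable_noise (h : IsEnvironment P 𝓕 H b w s₀ ν₀ s) (σ θ : ℝ) (ω : Ω) (r : ℝ≥0) :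
    Measurable[mΩ] fun ω' => noise σ θ b w ω ω' r :=
  (((h.b_meas r).mono h.H_le le_rfl).const_mul σ).add_const _

/-- The conditional mass of an event that depends on the position and the survival of the particle
at time `t` is computed by freezing the environment. -/
theorem condMass_ae_eq (h : IsEnvironment P 𝓕 H b w s₀ ν₀ s) {m : MeasurableSpace Ω} {t : ℝ≥0}
    (hm : 𝓕 t ≤ m) (hm' : m ≤ ⨆ r, 𝓕 r) {σ θ : ℝ} {E : ℝ → Set Ω} {A : Set (ℝ × Prop)}
    (hA : MeasurableSet A)
    (hE : ∀ᵐ ω ∂P, ∀ y, ω ∈ E y ↔ (y + noise σ θ b w ω ω t,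
      ∀ r ≤ t, s r ω < y + noise σ θ b w ω ω r) ∈ A) :
    condMass P m s₀ ν₀ E =ᵐ[P] fun ω => initLaw P s₀ ν₀ ω
      {p | (p.1 + noise σ θ b w ω p.2 t,
        p ∈ alive (noise σ θ b w ω) (fun r => s r ω) t) ∈ A} := by
  have hle : (⨆ r, 𝓕 r) ≤ mΩ := iSup_le 𝓕.le
  have hi : Indep m H P := indep_of_indep_of_le_left h.indep hm'
  have hw : ∀ r ≤ t, Measurable[m] (w r) := fun r hr =>
    (h.w_adapted r).mono ((𝓕.mono hr).trans hm) le_rfl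
  have hs : ∀ r ≤ t, Measurable[m] (s r) := fun r hr =>
    (h.s_adapted r).mono ((𝓕.mono hr).trans hm) le_rfl
  have hS := @measurableSet_survival Ω Ω m H w s b σ θ t h.w_cont h.b_cont h.s_mono h.s_rightCts
    hw hs h.b_meas
  have hpos : Measurable[(m.prod H).prod inferInstance] fun z : (Ω × Ω) × ℝ =>
      z.2 + noise σ θ b w z.1.1 z.1.2 t := by
    have h1 : Measurable[m.prod H] fun z : Ω × Ω => noise σ θ b w z.1 z.2 t :=
      (((h.b_meas t).comp (@measurable_snd _ _ m H)).const_mul σ).add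
        (((hw t le_rfl).comp (@measurable_fst _ _ m H)).const_mul θ)
    exact (@measurable_snd _ _ (m.prod H) _).add (h1.comp (@measurable_fst _ _ (m.prod H) _))
  have hpair : Measurable[(m.prod H).prod inferInstance] fun z : (Ω × Ω) × ℝ =>
      (z.2 + noise σ θ b w z.1.1 z.1.2 t,
        ∀ r ≤ t, s r z.1.1 < z.2 + noise σ θ b w z.1.1 z.1.2 r) :=
    hpos.prodMk (@measurableSet_setOfPred _ ((m.prod H).prod inferInstance) _ |>.1 hS)
  exact StefanMV.condMass_ae_eq (hm'.trans hle) h.H_le hi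
    (h.s₀_meas.mono ((𝓕.mono zero_le).trans hm) le_rfl)
    (h.ν₀_meas.mono ((𝓕.mono zero_le).trans hm) le_rfl) (hpair hA) hE

omit [IsProbabilityMeasure P] [∀ ω, IsFiniteMeasure (ν₀ ω)] in
theorem ae_lt_absorptionTime_iff (h : IsEnvironment P 𝓕 H b w s₀ ν₀ s) {κ θ : ℝ}
    {B W : ℝ≥0 → Ω → ℝ} (hbB : ∀ᵐ ω ∂P, ∀ t, b t ω = B t ω) (hwW : ∀ᵐ ω ∂P, ∀ t, w t ω = W t ω) :
    ∀ᵐ ω ∂P, ∀ y t, ((t : ℝ≥0) : ℝ≥0∞) < absorptionTime κ θ B W s y ω ↔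
      ∀ r ≤ t, s r ω < y + noise (√(2 * κ - θ ^ 2)) θ b w ω ω r := by
  filter_upwards [hbB, hwW] with ω hb hw y t
  have hB : Continuous fun t => B t ω := by simpa only [hb] using h.b_cont ω
  have hW : Continuous fun t => W t ω := by simpa only [hw] using h.w_cont ω
  rw [lt_absorptionTime_iff hB hW (h.s_mono ω) (h.s_rightCts ω)]
  simp only [noise, hb, hw]

/-- The displacement of the front is proportional to the absorbed mass, for the frozen
environment. -/
theorem ae_measure_compl_alive_eq (h : IsEnvironment P 𝓕 H b w s₀ ν₀ s) {lam κ θ : ℝ}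
    (hc : 0 < lam * κ) {B W : ℝ≥0 → Ω → ℝ} (hbB : ∀ᵐ ω ∂P, ∀ t, b t ω = B t ω)
    (hwW : ∀ᵐ ω ∂P, ∀ t, w t ω = W t ω) (hs : IsSolution P 𝓕 lam κ θ B W s₀ ν₀ s) (t : ℝ≥0) :
    ∀ᵐ ω ∂P, s₀ ω ≤ s t ω ∧ initLaw P s₀ ν₀ ω
      (alive (noise (√(2 * κ - θ ^ 2)) θ b w ω) (fun r => s r ω) t)ᶜ =
        ENNReal.ofReal (lam * κ * (s t ω - s₀ ω)) := by
  have hE : ∀ᵐ ω ∂P, ∀ y, ω ∈ {ω | absorptionTime κ θ B W s y ω ≤ t} ↔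
      (y + noise (√(2 * κ - θ ^ 2)) θ b w ω ω t,
      ∀ r ≤ t, s r ω < y + noise (√(2 * κ - θ ^ 2)) θ b w ω ω r) ∈
        {z : ℝ × Prop | ¬ z.2} := by
    filter_upwards [h.ae_lt_absorptionTime_iff hbB hwW] with ω hω y
    exact not_lt.symm.trans (not_congr (hω y t))
  have hA : MeasurableSet {z : ℝ × Prop | ¬ z.2} :=
    (measurable_snd (measurableSet_singleton True)).compl.congr (by ext z; simp)
  filter_upwards [hs.eq t, h.condMass_ae_eq le_rfl (le_iSup 𝓕 t) hA hE] with ω h1 h2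
  have h3 : initLaw P s₀ ν₀ ω {p | (p.1 + noise (√(2 * κ - θ ^ 2)) θ b w ω p.2 t,
        p ∈ alive (noise (√(2 * κ - θ ^ 2)) θ b w ω) (fun r => s r ω) t) ∈
          {z : ℝ × Prop | ¬ z.2}} =
      initLaw P s₀ ν₀ ω (alive (noise (√(2 * κ - θ ^ 2)) θ b w ω) (fun r => s r ω) t)ᶜ := rfl
  rw [h2.trans h3] at h1
  have h4 : lam * κ * (s t ω - s₀ ω) = (initLaw P s₀ ν₀ ω
      (alive (noise (√(2 * κ - θ ^ 2)) θ b w ω) (fun r => s r ω) t)ᶜ).toReal := by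
    rw [h1, add_sub_cancel_left, ← mul_assoc, mul_one_div_cancel hc.ne', one_mul]
  refine ⟨?_, ?_⟩
  · rw [h1]
    exact le_add_of_nonneg_right (mul_nonneg (one_div_pos.2 hc).le ENNReal.toReal_nonneg)
  · rw [h4, ENNReal.ofReal_toReal (measure_ne_top _ _)]

/-- The explicit version of the mass process: the law of the positions of the survivors, for the
frozen environment. -/
theorem isMassProcess_lawOn (h : IsEnvironment P 𝓕 H b w s₀ ν₀ s) {κ θ : ℝ}
    {B W : ℝ≥0 → Ω → ℝ} (hbB : ∀ᵐ ω ∂P, ∀ t, b t ω = B t ω)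
    (hwW : ∀ᵐ ω ∂P, ∀ t, w t ω = W t ω) :
    IsMassProcess P 𝓕 κ θ B W s₀ ν₀ s fun t ω => lawOn (initLaw P s₀ ν₀ ω)
      (alive (noise (√(2 * κ - θ ^ 2)) θ b w ω) (fun r => s r ω) t)
      fun p => p.1 + noise (√(2 * κ - θ ^ 2)) θ b w ω p.2 t where
  version t A hA := by
    have hE : ∀ᵐ ω ∂P, ∀ y, ω ∈ {ω | particle κ θ B W y t ω ∈ A ∧
        (t : ℝ≥0∞) < absorptionTime κ θ B W s y ω} ↔
        (y + noise (√(2 * κ - θ ^ 2)) θ b w ω ω t,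
        ∀ r ≤ t, s r ω < y + noise (√(2 * κ - θ ^ 2)) θ b w ω ω r) ∈
          {z : ℝ × Prop | z.1 ∈ A ∧ z.2} := by
      filter_upwards [h.ae_lt_absorptionTime_iff (κ := κ) (θ := θ) hbB hwW, hbB, hwW]
        with ω hω hb hw y
      have hp : particle κ θ B W y t ω = y + noise (√(2 * κ - θ ^ 2)) θ b w ω ω t := by
        simp only [noise, hb, hw, particle, add_assoc]
      have := hω y t
      change particle κ θ B W y t ω ∈ A ∧ _ ↔ _ ∧ _
      rw [hp, this]
    have hA' : MeasurableSet {z : ℝ × Prop | z.1 ∈ A ∧ z.2} :=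
      ((measurable_fst hA).inter (measurable_snd (measurableSet_singleton True))).congr
        (by ext z; simp)
    filter_upwards [h.condMass_ae_eq (le_iSup 𝓕 t) le_rfl hA' hE] with ω hω
    have hX : Measurable[Real.measurableSpace.prod mΩ] fun p : ℝ × Ω =>
        p.1 + noise (√(2 * κ - θ ^ 2)) θ b w ω p.2 t :=
      (@measurable_fst _ _ _ mΩ).add
        ((h.measurable_noise _ _ _ _).comp (@measurable_snd _ _ _ mΩ))
    rw [hω, lawOn, FiniteMeasure.toMeasure_mk, Measure.map_apply hX hA,
      Measure.restrict_apply (hX hA)]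
    rfl
  rightCts := Eventually.of_forall fun ω t => lawOn_alive_rightCts (h.noise_cont _ _ ω)
    (h.measurable_noise _ _ ω) (h.s_mono ω) (h.s_rightCts ω) t
  leftLims := Eventually.of_forall fun ω t _ => ⟨_, tendsto_lawOn_aliveBefore
    (h.noise_cont _ _ ω) (h.measurable_noise _ _ ω) (h.s_mono ω) (h.s_rightCts ω) t⟩

end IsEnvironment

omit [IsProbabilityMeasure P] [∀ ω, IsFiniteMeasure (ν₀ ω)] in
/-- Càdlàg versions of the mass process are indistinguishable. -/
theorem IsMassProcess.ae_eq {κ θ : ℝ} {B W : ℝ≥0 → Ω → ℝ} {ν ν' : ℝ≥0 → Ω → FiniteMeasure ℝ}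
    (h : IsMassProcess P 𝓕 κ θ B W s₀ ν₀ s ν) (h' : IsMassProcess P 𝓕 κ θ B W s₀ ν₀ s ν') :
    ∀ᵐ ω ∂P, (fun t => ν t ω) = fun t => ν' t ω := by
  have h1 : ∀ᵐ ω ∂P, ∀ i : ℕ, ν (denseSeq ℝ≥0 i) ω = ν' (denseSeq ℝ≥0 i) ω := by
    refine ae_all_iff.2 fun i => ?_
    have hq : ∀ᵐ ω ∂P, ∀ q : ℚ, (ν (denseSeq ℝ≥0 i) ω : Measure ℝ) (Iic (q : ℝ)) =
        (ν' (denseSeq ℝ≥0 i) ω : Measure ℝ) (Iic (q : ℝ)) := ae_all_iff.2 fun q => by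
      filter_upwards [h.version (denseSeq ℝ≥0 i) _ (measurableSet_Iic (a := (q : ℝ))),
        h'.version (denseSeq ℝ≥0 i) _ (measurableSet_Iic (a := (q : ℝ)))] with ω e1 e2
      rw [e1, e2]
    filter_upwards [hq, h.version (denseSeq ℝ≥0 i) _ MeasurableSet.univ,
      h'.version (denseSeq ℝ≥0 i) _ MeasurableSet.univ] with ω hω e1 e2
    refine FiniteMeasure.toMeasure_injective (ext_of_generate_finite _
      (BorelSpace.measurable_eq.trans Real.borel_eq_generateFrom_Iic_rat) Real.isPiSystem_Iic_rat
      ?_ (e1.trans e2.symm))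
    simp only [mem_iUnion, mem_singleton_iff]
    rintro _ ⟨q, rfl⟩
    exact hω q
  filter_upwards [h1, h.rightCts, h'.rightCts] with ω e1 e2 e3
  exact eq_of_rightCts_of_denseSeq e2 e3 e1

end Model

/-! ### Lower bound on the jump at a stopping time -/

section Jump

open TopologicalSpace

variable {Ω : Type*} {H mΩ : MeasurableSpace Ω}

/-- The law of the positions of the particles that survive on `[0, t)`, at time `t`, for the frozen
environment `ω`. -/
noncomputable def lawBefore (P : Measure Ω) [IsProbabilityMeasure P] (σ θ : ℝ)
    (b w : ℝ≥0 → Ω → ℝ) (s₀ : Ω → ℝ) (ν₀ : Ω → Measure ℝ) [∀ ω, IsFiniteMeasure (ν₀ ω)]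
    (s : ℝ≥0 → Ω → ℝ) (t : ℝ≥0) (ω : Ω) : FiniteMeasure ℝ :=
  lawOn (initLaw P s₀ ν₀ ω) (aliveBefore (noise σ θ b w ω) (fun r => s r ω) t)
    fun p => p.1 + noise σ θ b w ω p.2 t

/-- The event that at time `τ` the front jumps by less than `q`, although the mass just in front of
it has density at least `c` up to distance `q`. -/
def slowSet (P : Measure Ω) [IsProbabilityMeasure P] (σ θ : ℝ)
    (b w : ℝ≥0 → Ω → ℝ) (s₀ : Ω → ℝ) (ν₀ : Ω → Measure ℝ) [∀ ω, IsFiniteMeasure (ν₀ ω)]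
    (s : ℝ≥0 → Ω → ℝ) (τ : Ω → WithTop ℝ≥0) (c q : ℝ) : Set Ω :=
  {ω | ∃ t : ℝ≥0, τ ω = t ∧ s t ω - frontBefore s₀ s t ω < q ∧ ∀ y : ℚ, 0 < (y : ℝ) → y < q →
    ENNReal.ofReal (c * y) ≤ (lawBefore P σ θ b w s₀ ν₀ s t ω : Measure ℝ)
      (Icc (frontBefore s₀ s t ω) (frontBefore s₀ s t ω + y))}

variable {P : Measure Ω} [IsProbabilityMeasure P] {𝓕 : Filtration ℝ≥0 mΩ}
  {b w : ℝ≥0 → Ω → ℝ} {s₀ : Ω → ℝ} {ν₀ : Ω → Measure ℝ}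
  [∀ ω, IsFiniteMeasure (ν₀ ω)] {s : ℝ≥0 → Ω → ℝ} {τ : Ω → WithTop ℝ≥0}

theorem measurable_min_untopD (hτ : IsStoppingTime 𝓕 τ) (r : ℝ≥0) :
    Measurable[𝓕 r] fun ω => (min (τ ω) r).untopD 0 := by
  have key : ∀ (v : WithTop ℝ≥0) (a : ℝ≥0), (min v r).untopD 0 ≤ a ↔ r ≤ a ∨ v ≤ a := by
    intro v a
    induction v using WithTop.recTopCoe with
    | top =>
      rw [min_eq_right le_top, WithTop.untopD_coe]
      exact ⟨Or.inl, fun h => h.resolve_right (not_le.2 (WithTop.coe_lt_top a))⟩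
    | coe v =>
      rw [← WithTop.coe_min, WithTop.untopD_coe, min_le_iff, WithTop.coe_le_coe, or_comm]
  refine @measurable_of_Iic _ _ _ _ _ (𝓕 r) _ _ _ _ fun a => ?_
  by_cases ha : r ≤ a
  · convert @MeasurableSet.univ _ (𝓕 r)
    exact eq_univ_of_forall fun ω => (key _ _).2 (Or.inl ha)
  · have : (fun ω => (min (τ ω) r).untopD 0) ⁻¹' Iic a = {ω | τ ω ≤ a} := by
      ext ω
      exact (key _ _).trans (or_iff_right ha)
    rw [this]
    exact 𝓕.mono (not_le.1 ha).le _ (hτ a)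

/-- Before time `r` the time `τ` agrees with `min τ r`, which is `𝓕 r`-measurable. The value `0`
given to infinite times is harmless, since they are excluded from the event. -/
theorem measurableSet_slowSet_inter (h : IsEnvironment P 𝓕 H b w s₀ ν₀ s)
    (hτ : IsStoppingTime 𝓕 τ) (σ θ c q : ℝ) (r : ℝ≥0) :
    MeasurableSet[𝓕 r] (slowSet P σ θ b w s₀ ν₀ s τ c q ∩ {ω | (τ ω).untopD 0 < r}) := by
  set T : Ω → ℝ≥0 := fun ω => (min (τ ω) r).untopD 0 with hT_def
  have hT : Measurable[𝓕 r] T := measurable_min_untopD hτ r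
  have hTr : ∀ ω, T ω ≤ r := fun ω => by
    rw [hT_def]
    cases hω : τ ω using WithTop.recTopCoe with
    | top => simp only [hω, min_eq_right le_top, WithTop.untopD_coe, le_refl]
    | coe v => simp only [hω, ← WithTop.coe_min, WithTop.untopD_coe, min_le_right]
  have hws : ∀ u ≤ r, Measurable[𝓕 r] (w u) := fun u hu => (h.w_adapted u).mono (𝓕.mono hu) le_rfl
  have hss : ∀ u ≤ r, Measurable[𝓕 r] (s u) := fun u hu => (h.s_adapted u).mono (𝓕.mono hu) le_rfl
  have hs₀ : Measurable[𝓕 r] s₀ := h.s₀_meas.mono (𝓕.mono zero_le) le_rfl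
  have hν₀ : Measurable[𝓕 r] ν₀ := h.ν₀_meas.mono (𝓕.mono zero_le) le_rfl
  have hL : Measurable[𝓕 r] fun ω => frontBefore s₀ s (T ω) ω :=
    @measurable_frontBefore Ω (𝓕 r) s₀ s r hs₀ h.s_mono hss T hT hTr
  have hsT : Measurable[𝓕 r] fun ω => s (T ω) ω :=
    @measurable_eval_of_monotone Ω (𝓕 r) s h.s_mono h.s_rightCts r hss T hT hTr
  have hlaw : ∀ y : ℝ, Measurable[𝓕 r] fun ω => (lawBefore P σ θ b w s₀ ν₀ s (T ω) ω : Measure ℝ)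
      (Icc (frontBefore s₀ s (T ω) ω) (frontBefore s₀ s (T ω) ω + y)) := fun y =>
    @measurable_lawOn_aliveBefore Ω Ω (𝓕 r) mΩ s₀ w s b σ θ r P _ ν₀ _ hs₀ hν₀ h.w_cont h.b_cont
      h.s_mono h.s_rightCts hws hss (fun u => (h.b_meas u).mono h.H_le le_rfl) T hT hTr _ hL y
  have heq : slowSet P σ θ b w s₀ ν₀ s τ c q ∩ {ω | (τ ω).untopD 0 < r} =
      {ω | T ω < r} ∩ ({ω | s (T ω) ω - frontBefore s₀ s (T ω) ω < q} ∩
      ⋂ y : ℚ, {ω | 0 < (y : ℝ) → (y : ℝ) < q → ENNReal.ofReal (c * y) ≤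
        (lawBefore P σ θ b w s₀ ν₀ s (T ω) ω : Measure ℝ)
          (Icc (frontBefore s₀ s (T ω) ω) (frontBefore s₀ s (T ω) ω + y))}) := by
    ext ω
    simp only [slowSet, mem_inter_iff, mem_ofPred_eq, mem_iInter]
    cases hω : τ ω using WithTop.recTopCoe with
    | top =>
      have hTv : T ω = r := by simp only [hT_def, hω, min_eq_right le_top, WithTop.untopD_coe]
      simp only [hTv, lt_self_iff_false, false_and, WithTop.top_ne_coe, exists_false]
    | coe v =>
      have hTv : T ω = min v r := by simp only [hT_def, hω, ← WithTop.coe_min, WithTop.untopD_coe]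
      simp only [WithTop.untopD_coe, WithTop.coe_inj, exists_eq_left']
      rw [hTv]
      constructor
      · rintro ⟨⟨h1, h2⟩, h3⟩
        rw [min_eq_left h3.le]
        exact ⟨h3, h1, h2⟩
      · rintro ⟨h1, h2, h3⟩
        have hvr : v < r := by simpa using h1
        rw [min_eq_left hvr.le] at h2 h3
        exact ⟨⟨h2, h3⟩, hvr⟩
  rw [heq]
  refine @MeasurableSet.inter _ (𝓕 r) _ _ (measurableSet_lt hT (@measurable_const _ _ _ (𝓕 r) _))
    (@MeasurableSet.inter _ (𝓕 r) _ _
      (measurableSet_lt (hsT.sub hL) (@measurable_const _ _ _ (𝓕 r) _))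
      (@MeasurableSet.iInter _ _ (𝓕 r) _ _ fun y => ?_))
  by_cases hy : 0 < (y : ℝ) ∧ (y : ℝ) < q
  · simp only [hy.1, hy.2, forall_const]
    exact measurableSet_le (@measurable_const _ _ _ (𝓕 r) _) (hlaw y)
  · convert @MeasurableSet.univ _ (𝓕 r)
    rw [eq_univ_iff_forall]
    exact fun ω h1 h2 => absurd ⟨h1, h2⟩ hy

/-- At an optional time the common noise immediately takes non-positive increments with conditional
probability at least `1 / 2`, which is incompatible with a slow front. -/
theorem measure_slowSet_eq_zero (h : IsEnvironment P 𝓕 H b w s₀ ν₀ s)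
    {𝓖 : ℝ≥0 → MeasurableSpace Ω}
    (hmono : Monotone 𝓖) (h𝓖 : ∀ t, 𝓖 t ≤ mΩ) (h𝓕 : ∀ r t, r < t → 𝓕 r ≤ 𝓖 t) {σ θ c q : ℝ}
    (hc : 0 < c)
    (hsign : ∀ t u A, MeasurableSet[𝓖 t] A →
      P A / 2 ≤ P (A ∩ {ω | θ * w (t + u) ω ≤ θ * w t ω}))
    (hind : ∀ t u, t ≤ u → Indep (⨆ r ≤ t, MeasurableSpace.comap (b r) inferInstance)
      (MeasurableSpace.comap (fun ω => b u ω - b t ω) inferInstance) P)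
    (hint : ∀ t u, Integrable (fun ω => σ * (b u ω - b t ω)) P)
    (hsymm : ∀ t u, P.map (fun ω => -(σ * (b u ω - b t ω))) = P.map fun ω => σ * (b u ω - b t ω))
    (hpos : ∀ t u, t < u → ∀ z, 0 < P {ω | z < σ * (b u ω - b t ω)})
    (hsol : ∀ t, ∀ᵐ ω ∂P, s₀ ω ≤ s t ω ∧ initLaw P s₀ ν₀ ω
      (alive (noise σ θ b w ω) (fun r => s r ω) t)ᶜ = ENNReal.ofReal (c * (s t ω - s₀ ω)))
    (hτ : IsStoppingTime 𝓕 τ) :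
    P (slowSet P σ θ b w s₀ ν₀ s τ c q) = 0 := by
  set A := slowSet P σ θ b w s₀ ν₀ s τ c q with hA_def
  have hbm : ∀ r, Measurable (b r) := fun r => (h.b_meas r).mono h.H_le le_rfl
  have hA : ∀ r, MeasurableSet[𝓖 r] (A ∩ {ω | (τ ω).untopD 0 < r}) := fun r => by
    have : A ∩ {ω | (τ ω).untopD 0 < r} = ⋃ i : ℕ, ⋃ _ : denseSeq ℝ≥0 i < r,
        (A ∩ {ω | (τ ω).untopD 0 < denseSeq ℝ≥0 i}) := by
      ext ω
      simp only [mem_inter_iff, mem_ofPred_eq, mem_iUnion, exists_prop]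
      constructor
      · rintro ⟨h1, h2⟩
        obtain ⟨i, hi⟩ := (denseRange_denseSeq ℝ≥0).exists_mem_open isOpen_Ioo (nonempty_Ioo.2 h2)
        exact ⟨i, hi.2, h1, hi.1⟩
      · rintro ⟨i, hi, h1, h2⟩
        exact ⟨h1, h2.trans hi⟩
    rw [this]
    exact @MeasurableSet.iUnion _ _ (𝓖 r) _ _ fun i => @MeasurableSet.iUnion _ _ (𝓖 r) _ _ fun hi =>
      h𝓕 _ _ hi _ (measurableSet_slowSet_inter h hτ σ θ c q _)
  have hwm : ∀ t, Measurable fun ω => θ * w t ω := fun t =>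
    ((h.w_adapted t).mono (𝓕.le t) le_rfl).const_mul θ
  have hhalf := half_le_measure_frequently_le hmono h𝓖 hwm
    (fun ω => continuous_const.mul (h.w_cont ω)) hsign hA
  have hgood : ∀ᵐ ω ∂P, s₀ ω ≤ s 0 ω ∧ ∀ i, initLaw P s₀ ν₀ ω
      (alive (noise σ θ b w ω) (fun r => s r ω) (denseSeq ℝ≥0 i))ᶜ =
        ENNReal.ofReal (c * (s (denseSeq ℝ≥0 i) ω - s₀ ω)) := by
    filter_upwards [hsol 0, ae_all_iff.2 fun i => hsol (denseSeq ℝ≥0 i)] with ω h1 h2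
    exact ⟨h1.1, fun i => (h2 i).2⟩
  have hzero : P (A ∩ {ω | ∃ᶠ n : ℕ in atTop,
      θ * w ((τ ω).untopD 0 + 1 / ((n : ℝ≥0) + 1)) ω ≤ θ * w ((τ ω).untopD 0) ω}) = 0 := by
    rw [measure_eq_zero_iff_ae_notMem]
    filter_upwards [hgood] with ω ⟨h0, hD⟩ hω
    obtain ⟨⟨t, hτt, hJ, hdens⟩, hfreq⟩ := hω
    simp only [hτt, WithTop.untopD_coe, mem_ofPred_eq] at hfreq
    -- as the mesh tends to zero, the displacement of front and noise after time `t` vanishes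
    have hn : Tendsto (fun n : ℕ => t + 1 / ((n : ℝ≥0) + 1)) atTop (𝓝 t) := by
      simpa using tendsto_const_nhds.add (tendsto_one_div_add_atTop_nhds_zero_nat (𝕜 := ℝ≥0))
    have hn' : Tendsto (fun n : ℕ => t + 1 / ((n : ℝ≥0) + 1)) atTop (𝓝[≥] t) :=
      tendsto_nhdsWithin_iff.2 ⟨hn, Eventually.of_forall fun _ => mem_Ici.2 le_self_add⟩
    have hlim : Tendsto (fun n : ℕ => 2 * (s (t + 1 / ((n : ℝ≥0) + 1)) ω -
        (θ * w (t + 1 / ((n : ℝ≥0) + 1)) ω - θ * w t ω) - s t ω)) atTop (𝓝 0) := by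
      have h1 : Tendsto (fun n : ℕ => s (t + 1 / ((n : ℝ≥0) + 1)) ω) atTop (𝓝 (s t ω)) :=
        Tendsto.comp (h.s_rightCts ω t) hn'
      have h2 := (((h.w_cont ω).tendsto t).comp hn).const_mul θ
      have := ((h1.sub (h2.sub_const (θ * w t ω))).sub_const (s t ω)).const_mul 2
      simpa using this
    have hev := hlim.eventually (gt_mem_nhds (sub_pos.2 hJ))
    obtain ⟨n, hwn, hsmall⟩ := (hfreq.and_eventually hev).exists
    have htu : t < t + 1 / ((n : ℝ≥0) + 1) := lt_add_of_pos_right _ (by positivity)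
    have hdens' : ∀ y : ℝ, 0 < y → y < q → ENNReal.ofReal (c * y) ≤
        (lawBefore P σ θ b w s₀ ν₀ s t ω : Measure ℝ)
          (Icc (frontBefore s₀ s t ω) (frontBefore s₀ s t ω + y)) := by
      intro y hy hyq
      by_contra! hlt
      have hlt' : ((lawBefore P σ θ b w s₀ ν₀ s t ω : Measure ℝ)
          (Icc (frontBefore s₀ s t ω) (frontBefore s₀ s t ω + y))).toReal / c < y := by
        rw [div_lt_iff₀ hc, mul_comm]
        exact (ENNReal.lt_ofReal_iff_toReal_lt (measure_ne_top _ _)).1 hlt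
      obtain ⟨y', hy1, hy2⟩ := exists_rat_btwn hlt'
      have hy0 : (0 : ℝ) < y' := lt_of_le_of_lt (div_nonneg ENNReal.toReal_nonneg hc.le) hy1
      have hsub : Icc (frontBefore s₀ s t ω) (frontBefore s₀ s t ω + y') ⊆
          Icc (frontBefore s₀ s t ω) (frontBefore s₀ s t ω + y) :=
        Icc_subset_Icc_right (by linarith)
      have h1 := (hdens y' hy0 (hy2.trans hyq)).trans (measure_mono hsub)
      rw [ENNReal.ofReal_le_iff_le_toReal (measure_ne_top _ _)] at h1
      rw [div_lt_iff₀ hc, mul_comm] at hy1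
      linarith
    exact false_of_slow_front (P := P) (μ₀ := (ν₀ ω).restrict (Ici (s₀ ω))) (b := b)
      (w := fun r => θ * w r ω) (σ := σ) (f := fun r => s r ω) hbm h.b_cont
      (continuous_const.mul (h.w_cont ω)) (h.s_mono ω) (h.s_rightCts ω) htu.le
      (hind _ _ htu.le) (hint _ _) (hsymm _ _) (hpos _ _ htu) hc
      (frontBefore_le (h.s_mono ω) h0 t) hJ
      (measure_aliveBefore_diff_alive_le hc (h.noise_cont σ θ ω) (h.measurable_noise σ θ ω)
        (h.s_mono ω) (h.s_rightCts ω) h0 hD htu.le) hdens' hwn hsmall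
  rw [hzero] at hhalf
  simpa using hhalf

/-- A jump below the bound is separated from it by a rational `q`, and then the front is slow up to
distance `q`. -/
theorem ae_minimalJump_le_of_measure_slowSet {lam κ σ θ : ℝ} (hc : 0 < lam * κ)
    (hslow : ∀ q, P (slowSet P σ θ b w s₀ ν₀ s τ (lam * κ) q) = 0) :
    ∀ᵐ ω ∂P, ∀ t : ℝ≥0, τ ω = t →
      minimalJump lam κ (lawBefore P σ θ b w s₀ ν₀ s t ω) (frontBefore s₀ s t ω) ≤
        s t ω - frontBefore s₀ s t ω := by
  have hq : ∀ᵐ ω ∂P, ∀ q : ℚ, ω ∉ slowSet P σ θ b w s₀ ν₀ s τ (lam * κ) q :=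
    ae_all_iff.2 fun q => measure_eq_zero_iff_ae_notMem.1 (hslow q)
  filter_upwards [hq] with ω hω t ht
  by_contra! hlt
  obtain ⟨q, hq1, hq2⟩ := exists_rat_btwn hlt
  refine hω q ⟨t, ht, hq1, fun y hy hyq => ?_⟩
  have hnot : ¬ (0 < (y : ℝ) ∧ 1 / (lam * κ) * (lawBefore P σ θ b w s₀ ν₀ s t ω : Measure ℝ).real
      (Icc (frontBefore s₀ s t ω) (frontBefore s₀ s t ω + y)) < y) := fun hmem =>
    absurd (csInf_le (s := {z : ℝ | 0 < z ∧ 1 / (lam * κ) *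
      (lawBefore P σ θ b w s₀ ν₀ s t ω : Measure ℝ).real
        (Icc (frontBefore s₀ s t ω) (frontBefore s₀ s t ω + z)) < z})
      ⟨0, fun z hz => hz.1.le⟩ hmem) (not_le.2 (hyq.trans hq2))
  rw [not_and, not_lt] at hnot
  have := hnot hy
  rw [one_div, ← div_eq_inv_mul, le_div_iff₀ hc, mul_comm] at this
  exact (ENNReal.ofReal_le_iff_le_toReal (measure_ne_top _ _)).2 this

end Jump

/-! ### Brownian increments and the independence of the idiosyncratic noise -/

section Brownian

variable {Ω : Type*} {mΩ : MeasurableSpace Ω} {P : Measure Ω}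

open Classical in
/-- The process `X` with its discontinuous paths replaced by zero. -/
noncomputable def continuousModification (X : ℝ≥0 → Ω → ℝ) (t : ℝ≥0) (ω : Ω) : ℝ :=
  if Continuous fun r => X r ω then X t ω else 0

theorem continuous_continuousModification (X : ℝ≥0 → Ω → ℝ) (ω : Ω) :
    Continuous fun t => continuousModification X t ω := by
  by_cases h : Continuous fun r => X r ω
  · simp [continuousModification, h]
  · simp [continuousModification, h, continuous_const]

theorem ae_continuousModification_eq {X : ℝ≥0 → Ω → ℝ} (hX : ∀ᵐ ω ∂P, Continuous (X · ω)) :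
    ∀ᵐ ω ∂P, ∀ t, continuousModification X t ω = X t ω := by
  filter_upwards [hX] with ω hω t
  simp [continuousModification, hω]

theorem indep_past_increment [IsProbabilityMeasure P] {X : ℝ≥0 → Ω → ℝ}
    (hX : IsPreBrownianReal X P) {t u : ℝ≥0} (htu : t ≤ u) :
    Indep (⨆ r ≤ t, MeasurableSpace.comap (X r) inferInstance)
      (MeasurableSpace.comap (fun ω => X u ω - X t ω) inferInstance) P := by
  have h := (hX.indepFun_shift t).symm
  rw [IndepFun_iff_Indep] at h
  refine indep_of_indep_of_le h (iSup₂_le fun r hr => ?_) ?_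
  · have : Measurable[MeasurableSpace.comap (fun ω (v : Iic t) => X v ω) inferInstance] (X r) :=
      (measurable_pi_apply (⟨r, hr⟩ : Iic t)).comp (comap_measurable fun ω (v : Iic t) => X v ω)
    exact this.comap_le
  · have : Measurable[MeasurableSpace.comap (fun ω v => X (t + v) ω - X t ω) inferInstance]
        (fun ω => X (t + (u - t)) ω - X t ω) :=
      (measurable_pi_apply (u - t)).comp (comap_measurable fun ω v => X (t + v) ω - X t ω)
    rw [add_tsub_cancel_of_le htu] at this
    exact this.comap_le

theorem gaussianReal_zero_map_neg (v : ℝ≥0) :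
    (gaussianReal 0 v).map (fun z => -z) = gaussianReal 0 v := by
  rw [gaussianReal_map_neg, neg_zero]

theorem half_le_gaussianReal (v : ℝ≥0) (θ : ℝ) :
    (1 : ℝ≥0∞) / 2 ≤ gaussianReal 0 v {z | θ * z ≤ 0} := by
  have hm : MeasurableSet {z : ℝ | θ * z ≤ 0} :=
    measurableSet_le (measurable_id.const_mul θ) measurable_const
  have h1 : gaussianReal 0 v {z | 0 ≤ θ * z} = gaussianReal 0 v {z | θ * z ≤ 0} := by
    conv_rhs => rw [← gaussianReal_zero_map_neg, Measure.map_apply measurable_neg hm]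
    congr 1
    ext z
    simp
  have h2 : (1 : ℝ≥0∞) ≤ gaussianReal 0 v {z | θ * z ≤ 0} + gaussianReal 0 v {z | θ * z ≤ 0} := by
    nth_rewrite 2 [← h1]
    refine le_trans ?_ (measure_union_le _ _)
    rw [← measure_univ (μ := gaussianReal 0 v)]
    exact measure_mono fun z _ => le_total (θ * z) 0
  rw [← two_mul] at h2
  rw [ENNReal.div_le_iff_le_mul (by simp) (by simp), mul_comm]
  exact h2

theorem hasLaw_mul_increment {X : ℝ≥0 → Ω → ℝ} (hX : IsPreBrownianReal X P) (σ : ℝ)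
    (t u : ℝ≥0) : ∃ v : ℝ≥0, (σ ≠ 0 → t < u → v ≠ 0) ∧
      HasLaw (fun ω => σ * (X u ω - X t ω)) (gaussianReal 0 v) P := by
  have h := gaussianReal_const_mul (hX.hasLaw_sub u t) σ
  refine ⟨_, fun hσ htu => ?_, by simpa using h⟩
  have h1 : NNReal.mk (σ ^ 2) (sq_nonneg σ) ≠ 0 := fun h0 =>
    pow_ne_zero 2 hσ (congrArg NNReal.toReal h0)
  refine mul_ne_zero h1 fun h0 => htu.ne' (NNReal.coe_injective (nndist_eq_zero.1 h0))

theorem integrable_mul_increment {X : ℝ≥0 → Ω → ℝ} (hX : IsPreBrownianReal X P) (σ : ℝ)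
    (t u : ℝ≥0) : Integrable (fun ω => σ * (X u ω - X t ω)) P :=
  ((hX.integrable_eval u).sub (hX.integrable_eval t)).const_mul σ

theorem map_neg_mul_increment {X : ℝ≥0 → Ω → ℝ} (hX : IsPreBrownianReal X P) (σ : ℝ)
    (t u : ℝ≥0) : P.map (fun ω => -(σ * (X u ω - X t ω))) =
      P.map fun ω => σ * (X u ω - X t ω) := by
  obtain ⟨v, -, hv⟩ := hasLaw_mul_increment hX σ t u
  have h1 := gaussianReal_neg hv
  rw [neg_zero] at h1
  rw [hv.map_eq]
  exact h1.map_eq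

theorem measure_lt_mul_increment_pos {X : ℝ≥0 → Ω → ℝ} (hX : IsPreBrownianReal X P) {σ : ℝ}
    (hσ : σ ≠ 0) {t u : ℝ≥0} (htu : t < u) (z : ℝ) :
    0 < P {ω | z < σ * (X u ω - X t ω)} := by
  obtain ⟨v, hv0, hv⟩ := hasLaw_mul_increment hX σ t u
  have h1 : P {ω | z < σ * (X u ω - X t ω)} = gaussianReal 0 v (Ioi z) := by
    rw [← hv.map_eq, Measure.map_apply_of_aemeasurable hv.aemeasurable measurableSet_Ioi]
    rfl
  rw [h1, pos_iff_ne_zero]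
  intro h0
  have := gaussianReal_absolutelyContinuous' 0 (hv0 hσ htu) h0
  simp at this

variable [P.IsComplete] {B W : ℝ≥0 → Ω → ℝ} {s₀ : Ω → ℝ}
  {ν₀ : Ω → Measure ℝ}

theorem frontFiltration_le_augmentedFiltration (hWm : ∀ t, Measurable (W t))
    (hs₀ : Measurable s₀) (hν₀ : Measurable ν₀) {r t : ℝ≥0} (hrt : r < t) :
    frontFiltration P W hWm s₀ hs₀ ν₀ hν₀ r ≤ augmentedFiltration P W hWm s₀ hs₀ ν₀ hν₀ t := by
  rw [frontFiltration, Filtration.rightCont_eq]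
  exact iInf₂_le t hrt

theorem augmentedFiltration_le_eventuallyMeasurableSpace (hWm : ∀ t, Measurable (W t))
    (hs₀ : Measurable s₀) (hν₀ : Measurable ν₀) (t : ℝ≥0) :
    augmentedFiltration P W hWm s₀ hs₀ ν₀ hν₀ t ≤ eventuallyMeasurableSpace
      (MeasurableSpace.comap (fun ω => (s₀ ω, ν₀ ω)) inferInstance ⊔
        ⨆ r ≤ t, MeasurableSpace.comap (W r) inferInstance) (ae P) := by
  refine le_trans (sup_le_sup_right ?_ _) (sup_generateFrom_null_le _)
  have h1 : Measurable[MeasurableSpace.comap (fun ω => (s₀ ω, ν₀ ω)) inferInstance] s₀ :=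
    measurable_fst.comp (comap_measurable fun ω => (s₀ ω, ν₀ ω))
  have h2 : Measurable[MeasurableSpace.comap (fun ω => (s₀ ω, ν₀ ω)) inferInstance] ν₀ :=
    measurable_snd.comp (comap_measurable fun ω => (s₀ ω, ν₀ ω))
  exact sup_le (sup_le le_sup_right (h1.comap_le.trans le_sup_left))
    (h2.comap_le.trans le_sup_left)

theorem comap_le_comap_pair (u : ℝ≥0) :
    MeasurableSpace.comap (W u) inferInstance ≤ MeasurableSpace.comap
      (fun ω => ((fun t => B t ω), (fun t => W t ω))) inferInstance := by
  have : Measurable[MeasurableSpace.comap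
      (fun ω => ((fun t => B t ω), (fun t => W t ω))) inferInstance] (W u) :=
    (measurable_pi_apply u).comp (measurable_snd.comp
      (comap_measurable fun ω => ((fun t => B t ω), (fun t => W t ω))))
  exact this.comap_le

/-- A Brownian increment after time `t` has any given sign with conditional probability at least
`1 / 2`, given the information up to time `t`. -/
theorem half_le_measure_inter_increment_le [IsProbabilityMeasure P] (hW : IsBrownianReal W P)
    (hWm : ∀ t, Measurable (W t)) (hs₀ : Measurable s₀) (hν₀ : Measurable ν₀)
    (hindep : IndepFun (fun ω => (s₀ ω, ν₀ ω))
      (fun ω => ((fun t => B t ω), (fun t => W t ω))) P) (θ : ℝ) (t u : ℝ≥0) {A : Set Ω}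
    (hA : MeasurableSet[augmentedFiltration P W hWm s₀ hs₀ ν₀ hν₀ t] A) :
    P A / 2 ≤ P (A ∩ {ω | θ * continuousModification W (t + u) ω ≤
      θ * continuousModification W t ω}) := by
  rw [IndepFun_iff_Indep] at hindep
  have hΔm : Measurable fun ω => W (t + u) ω - W t ω := (hWm _).sub (hWm _)
  have hpast : (⨆ r ≤ t, MeasurableSpace.comap (W r) inferInstance) ≤ mΩ :=
    iSup₂_le fun r _ => (hWm r).comap_le
  have hle : (⨆ r ≤ t, MeasurableSpace.comap (W r) inferInstance) ⊔
      MeasurableSpace.comap (fun ω => W (t + u) ω - W t ω) inferInstance ≤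
      MeasurableSpace.comap (fun ω => ((fun t => B t ω), (fun t => W t ω))) inferInstance := by
    refine sup_le (iSup₂_le fun r _ => comap_le_comap_pair r) ?_
    have : Measurable[MeasurableSpace.comap (fun ω => ((fun t => B t ω), (fun t => W t ω)))
        inferInstance] (fun ω => W (t + u) ω - W t ω) :=
      ((measurable_pi_apply (t + u)).comp (measurable_snd.comp
        (comap_measurable fun ω => ((fun t => B t ω), (fun t => W t ω))))).sub
        ((measurable_pi_apply t).comp (measurable_snd.comp
        (comap_measurable fun ω => ((fun t => B t ω), (fun t => W t ω)))))
    exact this.comap_le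
  have hind := indep_eventuallyMeasurableSpace (indep_sup_left_of_indep
    (hs₀.prodMk hν₀).comap_le hpast hΔm.comap_le (indep_of_indep_of_le_right hindep hle)
    (indep_past_increment hW.toIsPreBrownianReal (le_self_add : t ≤ t + u)))
  have hS : MeasurableSet {z : ℝ | θ * z ≤ 0} :=
    measurableSet_le (measurable_id.const_mul θ) measurable_const
  have hlaw : (1 : ℝ≥0∞) / 2 ≤ P ((fun ω => W (t + u) ω - W t ω) ⁻¹' {z | θ * z ≤ 0}) := by
    have h := hW.toIsPreBrownianReal.hasLaw_sub (t + u) t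
    have h' : P ((fun ω => W (t + u) ω - W t ω) ⁻¹' {z | θ * z ≤ 0}) = _ :=
      (Measure.map_apply hΔm hS).symm.trans (congrArg (fun μ => μ {z | θ * z ≤ 0}) h.map_eq)
    rw [h']
    exact half_le_gaussianReal _ θ
  rw [Indep_iff] at hind
  have hmul := hind A ((fun ω => W (t + u) ω - W t ω) ⁻¹' {z | θ * z ≤ 0})
    (augmentedFiltration_le_eventuallyMeasurableSpace hWm hs₀ hν₀ t _ hA)
    (le_eventuallyMeasurableSpace _ ⟨_, hS, rfl⟩)
  have hae : (A ∩ (fun ω => W (t + u) ω - W t ω) ⁻¹' {z | θ * z ≤ 0} : Set Ω) =ᵐ[P]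
      (A ∩ {ω | θ * continuousModification W (t + u) ω ≤ θ * continuousModification W t ω} :
        Set Ω) := by
    refine (ae_eq_refl A).inter (eventuallyEq_set.2 ?_)
    filter_upwards [ae_continuousModification_eq hW.cont] with ω hω
    simp only [mem_preimage, mem_ofPred_eq, hω]
    rw [mul_sub, sub_nonpos]
  rw [← measure_congr hae, hmul, ENNReal.div_eq_inv_mul, mul_comm]
  gcongr
  simpa using hlaw

/-- The idiosyncratic Brownian motion is independent of `s₀`, `ν₀` and the common Brownian motion
jointly, hence of the whole filtration. -/
theorem isEnvironment_continuousModification [IsProbabilityMeasure P]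
    (hB : IsBrownianReal B P) (hW : IsBrownianReal W P)
    (hWm : ∀ t, Measurable (W t))
    (hBW : IndepFun (fun ω t => B t ω) (fun ω t => W t ω) P)
    (hs₀ : Measurable s₀) (hν₀ : Measurable ν₀)
    (hindep : IndepFun (fun ω => (s₀ ω, ν₀ ω))
      (fun ω => ((fun t => B t ω), (fun t => W t ω))) P)
    {lam κ θ : ℝ} {s : ℝ≥0 → Ω → ℝ}
    (hs : IsSolution P (frontFiltration P W hWm s₀ hs₀ ν₀ hν₀) lam κ θ B W s₀ ν₀ s) :
    IsEnvironment P (frontFiltration P W hWm s₀ hs₀ ν₀ hν₀)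
      (eventuallyMeasurableSpace (MeasurableSpace.comap (fun ω t => B t ω) inferInstance) (ae P))
      (continuousModification B) (continuousModification W) s₀ ν₀ s := by
  have hBm : ∀ t, Measurable (B t) := fun t =>
    (hB.toIsPreBrownianReal.aemeasurable t).nullMeasurable.measurable_of_complete
  have hBp : Measurable fun ω t => B t ω := measurable_pi_lambda _ hBm
  have hWp : Measurable fun ω t => W t ω := measurable_pi_lambda _ hWm
  have haug : ∀ t, augmentedFiltration P W hWm s₀ hs₀ ν₀ hν₀ t ≤
      frontFiltration P W hWm s₀ hs₀ ν₀ hν₀ t := fun t => Filtration.le_rightCont _ t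
  have hnull : ∀ t N, P N = 0 → MeasurableSet[frontFiltration P W hWm s₀ hs₀ ν₀ hν₀ t] N :=
    fun t N hN => haug t _ ((le_sup_right : MeasurableSpace.generateFrom {N | P N = 0} ≤
      augmentedFiltration P W hWm s₀ hs₀ ν₀ hν₀ t) _
        (MeasurableSpace.measurableSet_generateFrom hN))
  refine ⟨continuous_continuousModification B, continuous_continuousModification W, hs.mono,
    hs.rightCts, hs.adapted, fun t => ?_, ?_, ?_, eventuallyMeasurableSpace_le hBp.comap_le,
    fun t => ?_, ?_⟩
  · have h1 : Measurable[frontFiltration P W hWm s₀ hs₀ ν₀ hν₀ t] (W t) := by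
      refine Measurable.mono (comap_measurable (W t)) (le_trans ?_ (haug t)) le_rfl
      exact le_trans (le_iSup₂ (f := fun r (_ : r ≤ t) => MeasurableSpace.comap (W r) inferInstance)
        t le_rfl) (le_sup_left.trans (le_sup_left.trans le_sup_left))
    refine measurable_of_ae_eq (hnull t) h1 ?_
    filter_upwards [ae_continuousModification_eq hW.cont] with ω hω using (hω t).symm
  · refine Measurable.mono (comap_measurable s₀) (le_trans ?_ (haug 0)) le_rfl
    exact le_sup_right.trans (le_sup_left.trans le_sup_left)
  · refine Measurable.mono (comap_measurable ν₀) (le_trans ?_ (haug 0)) le_rfl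
    exact le_sup_right.trans le_sup_left
  · have h1 : Measurable[MeasurableSpace.comap (fun ω t => B t ω) inferInstance] (B t) :=
      (measurable_pi_apply t).comp (comap_measurable fun ω t => B t ω)
    have hN0 : ∀ N, P N = 0 → MeasurableSet[eventuallyMeasurableSpace
        (MeasurableSpace.comap (fun ω t => B t ω) inferInstance) (ae P)] N :=
      fun N hN => ⟨∅, @MeasurableSet.empty Ω
        (MeasurableSpace.comap (fun ω t => B t ω) inferInstance), ae_eq_empty.2 hN⟩
    refine measurable_of_ae_eq hN0 (h1.mono le_eventuallyMeasurableSpace le_rfl) ?_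
    filter_upwards [ae_continuousModification_eq hB.cont] with ω hω using (hω t).symm
  · rw [IndepFun_iff_Indep] at hindep hBW
    have hle : MeasurableSpace.comap (fun ω t => W t ω) inferInstance ⊔
        MeasurableSpace.comap (fun ω t => B t ω) inferInstance ≤
        MeasurableSpace.comap (fun ω => ((fun t => B t ω), (fun t => W t ω))) inferInstance := by
      refine sup_le ?_ ?_
      · exact (measurable_snd.comp (comap_measurable
          fun ω => ((fun t => B t ω), (fun t => W t ω)))).comap_le
      · exact (measurable_fst.comp (comap_measurable
          fun ω => ((fun t => B t ω), (fun t => W t ω)))).comap_le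
    have hi := indep_eventuallyMeasurableSpace (indep_sup_left_of_indep
      (hs₀.prodMk hν₀).comap_le hWp.comap_le hBp.comap_le
      (indep_of_indep_of_le_right hindep hle) hBW.symm)
    refine indep_of_indep_of_le_left hi (iSup_le fun r => ?_)
    refine (frontFiltration_le_augmentedFiltration hWm hs₀ hν₀ (lt_add_one r)).trans
      ((augmentedFiltration_le_eventuallyMeasurableSpace hWm hs₀ hν₀ (r + 1)).trans ?_)
    have hmono : MeasurableSpace.comap (fun ω => (s₀ ω, ν₀ ω)) inferInstance ⊔
        (⨆ v ≤ r + 1, MeasurableSpace.comap (W v) inferInstance) ≤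
        MeasurableSpace.comap (fun ω => (s₀ ω, ν₀ ω)) inferInstance ⊔
          MeasurableSpace.comap (fun ω t => W t ω) inferInstance :=
      sup_le_sup_left (iSup₂_le fun v _ =>
        ((measurable_pi_apply v).comp (comap_measurable fun ω t => W t ω)).comap_le) _
    rintro S ⟨S', hS', hSS⟩
    exact ⟨S', hmono _ hS', hSS⟩

end Brownian

/-! ### The bound for Brownian noise -/

section Solution

variable {Ω : Type*} {mΩ : MeasurableSpace Ω} {P : Measure Ω} [IsProbabilityMeasure P]
  {b w : ℝ≥0 → Ω → ℝ} {s₀ : Ω → ℝ} {ν₀ : Ω → Measure ℝ} [∀ ω, IsFiniteMeasure (ν₀ ω)]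
  {s : ℝ≥0 → Ω → ℝ}

theorem coe_lawBefore_zero {σ θ : ℝ} {ω : Ω} (hb : ∀ᵐ ω' ∂P, b 0 ω' = 0) (hw : w 0 ω = 0) :
    (lawBefore P σ θ b w s₀ ν₀ s 0 ω : Measure ℝ) = (ν₀ ω).restrict (Ici (s₀ ω)) := by
  have hall : aliveBefore (noise σ θ b w ω) (fun r => s r ω) 0 = univ :=
    eq_univ_of_forall fun p r hr => absurd hr not_lt_zero
  have hae : (fun p : ℝ × Ω => p.1 + noise σ θ b w ω p.2 0) =ᵐ[initLaw P s₀ ν₀ ω] Prod.fst := by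
    have h := (Measure.quasiMeasurePreserving_snd
      (μ := (ν₀ ω).restrict (Ici (s₀ ω))) (ν := P)).ae hb
    filter_upwards [h] with p hp
    simp [noise, hp, hw]
  change ((initLaw P s₀ ν₀ ω).restrict _).map _ = _
  rw [hall, Measure.restrict_univ, Measure.map_congr hae, initLaw, Measure.map_fst_prod,
    measure_univ, one_smul]

theorem minimalJump_restrict_Ici (lam κ : ℝ) (μ : Measure ℝ) (x : ℝ) :
    minimalJump lam κ (μ.restrict (Ici x)) x = minimalJump lam κ μ x := by
  have h : ∀ y, (μ.restrict (Ici x)).real (Icc x (x + y)) = μ.real (Icc x (x + y)) := fun y => by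
    rw [Measure.real, Measure.restrict_apply measurableSet_Icc,
      inter_eq_left.2 Icc_subset_Ici_self, Measure.real]
  simp only [minimalJump, h]

end Solution

end StefanMV

/-- Lower bound on the jump discontinuities of the freezing front. -/
theorem mainTheorem11 {Ω : Type*} {mΩ : MeasurableSpace Ω} (P : Measure Ω)
    [IsProbabilityMeasure P] [P.IsComplete]
    (lam κ θ : ℝ) (hlam : 0 < lam) (hκ : 0 < κ) (hθ : |θ| < √(2 * κ))
    (B W : ℝ≥0 → Ω → ℝ) (hB : IsBrownianReal B P) (hW : IsBrownianReal W P)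
    (hWm : ∀ t, Measurable (W t))
    (hBW : IndepFun (fun ω t => B t ω) (fun ω t => W t ω) P)
    (s₀ : Ω → ℝ) (hs₀ : Measurable s₀) (hs₀_nonneg : ∀ ω, 0 ≤ s₀ ω)
    (ν₀ : Ω → Measure ℝ) (hν₀ : Measurable ν₀) (hν₀_fin : ∀ ω, IsFiniteMeasure (ν₀ ω))
    (hν₀_supp : ∀ᵐ ω ∂P, ν₀ ω (Iio (s₀ ω)) = 0)
    (hindep : IndepFun (fun ω => (s₀ ω, ν₀ ω))
      (fun ω => ((fun t => B t ω), (fun t => W t ω))) P)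
    (s : ℝ≥0 → Ω → ℝ)
    (hs : StefanMV.IsSolution P (StefanMV.frontFiltration P W hWm s₀ hs₀ ν₀ hν₀)
      lam κ θ B W s₀ ν₀ s) :
    (∀ᵐ ω ∂P, StefanMV.minimalJump lam κ (ν₀ ω) (s₀ ω) ≤ s 0 ω - s₀ ω) ∧
    (∃ ν, StefanMV.IsMassProcess P (StefanMV.frontFiltration P W hWm s₀ hs₀ ν₀ hν₀)
      κ θ B W s₀ ν₀ s ν) ∧
    (∀ ν, StefanMV.IsMassProcess P (StefanMV.frontFiltration P W hWm s₀ hs₀ ν₀ hν₀)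
        κ θ B W s₀ ν₀ s ν →
      ∀ τ : Ω → WithTop ℝ≥0,
        IsStoppingTime (StefanMV.frontFiltration P W hWm s₀ hs₀ ν₀ hν₀) τ →
        ∀ᵐ ω ∂P, ∀ t : ℝ≥0, τ ω = t → 0 < t →
          StefanMV.minimalJump lam κ
              ((Function.leftLim (fun r => ν r ω) t : FiniteMeasure ℝ) : Measure ℝ)
              (Function.leftLim (fun r => s r ω) t) ≤
            s t ω - Function.leftLim (fun r => s r ω) t) := by
  open StefanMV in
  have hc : 0 < lam * κ := mul_pos hlam hκ
  have hσ : √(2 * κ - θ ^ 2) ≠ 0 := by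
    refine (Real.sqrt_pos.2 (sub_pos.2 ?_)).ne'
    rw [← sq_abs]
    exact (Real.lt_sqrt (abs_nonneg θ)).1 hθ
  have h := isEnvironment_continuousModification hB hW hWm hBW hs₀ hν₀ hindep hs
  have hbB := ae_continuousModification_eq hB.cont
  have hwW := ae_continuousModification_eq hW.cont
  have hb : IsPreBrownianReal (continuousModification B) P :=
    hB.toIsPreBrownianReal.congr fun t => by
      filter_upwards [hbB] with ω hω using (hω t).symm
  have hw : IsPreBrownianReal (continuousModification W) P :=
    hW.toIsPreBrownianReal.congr fun t => by
      filter_upwards [hwW] with ω hω using (hω t).symm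
  -- The bound for all stopping times, where `0` is allowed and plays the role of a jump from `s₀`.
  have hjump : ∀ τ : Ω → WithTop ℝ≥0, IsStoppingTime (frontFiltration P W hWm s₀ hs₀ ν₀ hν₀) τ →
      ∀ᵐ ω ∂P, ∀ t : ℝ≥0, τ ω = t →
        minimalJump lam κ (lawBefore P (√(2 * κ - θ ^ 2)) θ (continuousModification B)
          (continuousModification W) s₀ ν₀ s t ω) (frontBefore s₀ s t ω) ≤
          s t ω - frontBefore s₀ s t ω := fun τ hτ =>
    ae_minimalJump_le_of_measure_slowSet hc fun q =>
      measure_slowSet_eq_zero (𝓖 := fun t => augmentedFiltration P W hWm s₀ hs₀ ν₀ hν₀ t) h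
        (fun _ _ htu => (augmentedFiltration P W hWm s₀ hs₀ ν₀ hν₀).mono htu)
        (augmentedFiltration P W hWm s₀ hs₀ ν₀ hν₀).le
        (fun r t hrt => frontFiltration_le_augmentedFiltration hWm hs₀ hν₀ hrt) hc
        (fun t u A hA => half_le_measure_inter_increment_le hW hWm hs₀ hν₀ hindep θ t u hA)
        (fun t u htu => indep_past_increment hb htu) (integrable_mul_increment hb _)
        (map_neg_mul_increment hb _) (fun t u htu => measure_lt_mul_increment_pos hb hσ htu)
        (h.ae_measure_compl_alive_eq hc hbB hwW hs) hτ
  refine ⟨?_, ⟨_, h.isMassProcess_lawOn hbB hwW⟩, fun ν hν τ hτ => ?_⟩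
  · filter_upwards [hjump (fun _ => ((0 : ℝ≥0) : WithTop ℝ≥0)) (isStoppingTime_const _ 0),
      hw.eval_zero_ae_eq_zero] with ω hω hω0
    have h0 := hω 0 rfl
    rwa [frontBefore, if_pos rfl, coe_lawBefore_zero hb.eval_zero_ae_eq_zero hω0,
      minimalJump_restrict_Ici] at h0
  · filter_upwards [hjump τ hτ, hν.ae_eq (h.isMassProcess_lawOn hbB hwW)] with ω hω hνω t ht h0
    have : NeBot (𝓝[<] t) := nhdsLT_neBot_of_exists_lt ⟨0, h0⟩
    have hlim : Function.leftLim (fun r => ν r ω) t = lawBefore P (√(2 * κ - θ ^ 2)) θ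
        (continuousModification B) (continuousModification W) s₀ ν₀ s t ω := by
      rw [hνω]
      exact leftLim_eq_of_tendsto (tendsto_lawOn_aliveBefore (h.noise_cont _ θ ω)
        (h.measurable_noise _ θ ω) (h.s_mono ω) (h.s_rightCts ω) t)
    have h1 := hω t ht
    rwa [frontBefore, if_neg h0.ne', ← hlim] at h1
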